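/- Let $n\in\mathbb N$, $n\ge 1$. A variable exponent is a measurable function $p:\mathbb R^n\to(0,\infty]$ with $p^-:=\operatorname{ess\,inf} p>0$. For such $p$, a measurable set $B\subset\mathbb R^n$ and a measurable complex or extended real-valued function $g$, put $\|g\|_{L_{p(\cdot)}(B)}:=\inf\{\lambda>0:\int_B \phi_{p(x)}(|g(x)|/\lambda)\,dx\le 1\}$ (with $\inf\emptyset=\infty$), where $\phi_r(t)=t^r$ for $r<\infty$, and $\phi_\infty(t)=0$ for $t\in[0,1]$, $\phi_\infty(t)=\infty$ for $t>1$. For variable exponents $p,q,u$ with $p(x)\le u(x)$ for all $x$, put $$\|g\|_{M^{u(\cdot)}_{p(\cdot)}}:=\sup_{x\in\mathbb R^n,\,r>0} r^{n\left(\frac1{u(x)}-\frac1{p(x)}\right)}\|g\|_{L_{p(\cdot)}(B_r(x))},\qquad \|(g_j)_j\|_{M^{u(\cdot)}_{p(\cdot)}(\ell_{q(\cdot)})}:=\Big\|\Big(\sum_{j=0}^\infty|g_j(\cdot)|^{q(\cdot)}\Big)^{1/q(\cdot)}\Big\|_{M^{u(\cdot)}_{p(\cdot)}},$$ with $1/\infty=0$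 and with the inner sum replaced by $\sup_j|g_j(x)|$ where $q(x)=\infty$. For reals $\alpha_1\le\alpha_2$ and $\alpha\ge0$ let $\mathcal W^{\alpha}_{\alpha_1,\alpha_2}$ be the class of sequences $(w_j)_{j\in\mathbb N_0}$ of measurable functions $w_j:\mathbb R^n\to(0,\infty)$ such that, for some constant $C>0$ and all $x,y\in\mathbb R^n$, $j\in\mathbb N_0$, $w_j(x)\le C\,w_j(y)(1+2^j|x-y|)^\alpha$ and $2^{\alpha_1}w_j(x)\le w_{j+1}(x)\le 2^{\alpha_2}w_j(x)$. For Schwartz functions $\psi_0,\psi_1\in\mathcal S(\mathbb R^n)$ (complex-valued) let $\psi_j(x):=\psi_1(2^{-j+1}x)$ for $j\ge2$ and $\Psi_j:=\hat\psi_j$ for all $j\in\mathbb N_0$, where $\hat\psi(x)=(2\pi)^{-n/2}\int_{\mathbb R^n}e^{-ix\cdot\xi}\psi(\xi)\,d\xi$; define $\phi_j$, $\Phi_j=\hat\phi_j$ from $\phi_0,\phi_1\in\mathcal S(\mathbb R^n)$ in the same way. For $a>0$ and a tempered distribution $f\in\mathcal S'(\mathbb R^n)$ the Peetre maximal function is $$(\Psi_j^*f)_a(x):=\sup_{y\in\mathbb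 R^n}\frac{|(\Psi_j*f)(y)|}{1+|2^j(y-x)|^a}\in[0,\infty],\qquad x\in\mathbb R^n .$$ **Theorem.** Let $(w_j)_j\in\mathcal W^{\alpha}_{\alpha_1,\alpha_2}$, let $p,q,u$ be variable exponents with $p\le u$, let $a>0$ and let $R\in\mathbb N_0$ with $R>\alpha_2$. Let $\psi_0,\psi_1\in\mathcal S(\mathbb R^n)$ with $D^\beta\psi_1(0)=0$ for all multi-indices $\beta$ with $0\le|\beta|<R$, and let $\phi_0,\phi_1\in\mathcal S(\mathbb R^n)$ be such that, for some $\varepsilon>0$ and $k\in(1,2]$, $|\phi_0(x)|>0$ whenever $|x|\le k\varepsilon$, and $|\phi_1(x)|>0$ whenever $\varepsilon\le|x|\le 2k\varepsilon$. Then there is a constant $c>0$ such that $$\|((\Psi_j^*f)_a\,w_j)_j\|_{M^{u(\cdot)}_{p(\cdot)}(\ell_{q(\cdot)})}\le c\,\|((\Phi_j^*f)_a\,w_j)_j\|_{M^{u(\cdot)}_{p(\cdot)}(\ell_{q(\cdot)})}\qquad\text{for every } f\in\mathcal S'(\mathbb R^n).$$ (Both sides are elements of $[0,\infty]$.) -/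

import Mathlib

open MeasureTheory
open scoped ENNReal SchwartzMap FourierTransform LineDeriv

namespace VarMorrey

noncomputable section

/-- Euclidean space `ℝⁿ`. -/
abbrev Rn (n : ℕ) := EuclideanSpace ℝ (Fin n)

/-! ### Variable exponents, Lebesgue and Morrey quasi-norms

The quasi-norms only see `|f|`, so they are defined for functions with values in `[0, ∞]`. -/

/-- Variable exponents: measurable `p : ℝⁿ → (0, ∞]` with `ess inf p > 0`. -/
structure IsVarExponent {n : ℕ} (p : Rn n → ℝ≥0∞) : Prop where
  measurable : Measurable p
  pos : ∀ x, 0 < p x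
  essInf_pos : 0 < essInf p volume

/-- `φ_p(t) = t ^ p` for `p < ∞`; for `p = ∞` it is `0` on `[0, 1]` and `∞` on `(1, ∞]`. -/
def phi (p t : ℝ≥0∞) : ℝ≥0∞ :=
  if p = ∞ then (if t ≤ 1 then 0 else ∞) else t ^ p.toReal

/-- The semimodular of `L_{p(·)}(B)`. -/
def modular {n : ℕ} (p : Rn n → ℝ≥0∞) (B : Set (Rn n)) (f : Rn n → ℝ≥0∞) : ℝ≥0∞ :=
  ∫⁻ x in B, phi (p x) (f x)

/-- The Luxemburg quasi-norm of `L_{p(·)}(B)`, with value `∞` outside of the space. -/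
def lebesgueNorm {n : ℕ} (p : Rn n → ℝ≥0∞) (B : Set (Rn n)) (f : Rn n → ℝ≥0∞) : ℝ≥0∞ :=
  sInf {l : ℝ≥0∞ | 0 < l ∧ l < ∞ ∧ modular p B (fun x => f x / l) ≤ 1}

/-- The Morrey quasi-norm of `M_{p(·)}^{u(·)}(ℝⁿ)`:
`sup_{x, r > 0} r ^ (n (1 / u(x) - 1 / p(x))) ‖f‖_{L_{p(·)}(B_r(x))}`. -/
def morreyNorm {n : ℕ} (p u : Rn n → ℝ≥0∞) (f : Rn n → ℝ≥0∞) : ℝ≥0∞ :=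
  ⨆ (x : Rn n) (r : ℝ) (_ : 0 < r),
    ENNReal.ofReal (r ^ ((n : ℝ) * (((u x)⁻¹).toReal - ((p x)⁻¹).toReal))) *
      lebesgueNorm p (Metric.ball x r) f

/-- The `ℓ_q` quasi-norm of a sequence, `0 < q ≤ ∞`. -/
def ellNorm (q : ℝ≥0∞) (g : ℕ → ℝ≥0∞) : ℝ≥0∞ :=
  if q = ∞ then ⨆ j, g j else (∑' j, g j ^ q.toReal) ^ (1 / q.toReal)

/-- The quasi-norm of `M_{p(·)}^{u(·)}(ℓ_{q(·)})`. -/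
def morreyEllNorm {n : ℕ} (p u q : Rn n → ℝ≥0∞) (g : ℕ → Rn n → ℝ≥0∞) : ℝ≥0∞ :=
  morreyNorm p u (fun x => ellNorm (q x) (fun j => g j x))

/-! ### Admissible weights -/

/-- The class `W^α_{α₁,α₂}` of admissible weight sequences. -/
structure IsAdmissibleWeight {n : ℕ} (α α₁ α₂ : ℝ) (w : ℕ → Rn n → ℝ) : Prop where
  le_exponents : α₁ ≤ α₂
  nonneg : 0 ≤ α
  measurable : ∀ j, Measurable (w j)
  pos : ∀ j x, 0 < w j x
  growth : ∃ C : ℝ, 0 < C ∧ ∀ j x y, w j x ≤ C * w j y * (1 + 2 ^ j * ‖x - y‖) ^ α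
  lower : ∀ j x, (2 : ℝ) ^ α₁ * w j x ≤ w (j + 1) x
  upper : ∀ j x, w (j + 1) x ≤ (2 : ℝ) ^ α₂ * w j x

/-! ### Dilations, Fourier transform, convolution, Peetre maximal function -/

/-- The dilation `x ↦ ψ (t x)`, `t ≠ 0`. -/
def dilate {n : ℕ} (t : ℝ) (ht : t ≠ 0) (ψ : 𝓢(Rn n, ℂ)) : 𝓢(Rn n, ℂ) :=
  SchwartzMap.compCLMOfContinuousLinearEquiv ℂ
    (ContinuousLinearEquiv.smulLeft (R₁ := ℝ) (M₁ := Rn n) (Units.mk0 t ht)) ψ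

theorem dilate_apply {n : ℕ} (t : ℝ) (ht : t ≠ 0) (ψ : 𝓢(Rn n, ℂ)) (x : Rn n) :
    dilate t ht ψ x = ψ (t • x) := rfl

/-- The system generated by `ψ₀, ψ₁`: `ψ_j (x) = ψ₁ (2 ^ (-j + 1) x)` for `j ≥ 1`. -/
def dyadicSystem {n : ℕ} (ψ₀ ψ₁ : 𝓢(Rn n, ℂ)) : ℕ → 𝓢(Rn n, ℂ)
  | 0 => ψ₀
  | j + 1 => dilate (((2 : ℝ) ^ j)⁻¹) (by positivity) ψ₁

/-- The Fourier transform
`ψ̂(x) = (2π) ^ (-n/2) ∫ e ^ (-i x·ξ) ψ(ξ) dξ` on the Schwartz space,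
see `fourierHat_apply`; Mathlib's `𝓕` has the kernel `e ^ (-2πi x·ξ)` and no prefactor. -/
def fourierHat {n : ℕ} (ψ : 𝓢(Rn n, ℂ)) : 𝓢(Rn n, ℂ) :=
  (((2 * Real.pi) ^ (-(n : ℝ) / 2) : ℝ) : ℂ) •
    dilate ((2 * Real.pi)⁻¹) (by positivity) (𝓕 ψ)

theorem fourierHat_apply {n : ℕ} (ψ : 𝓢(Rn n, ℂ)) (x : Rn n) :
    fourierHat ψ x = (((2 * Real.pi) ^ (-(n : ℝ) / 2) : ℝ) : ℂ) *
      ∫ ξ : Rn n, Complex.exp (-Complex.I * (inner ℝ x ξ : ℝ)) * ψ ξ := by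
  have h : fourierHat ψ x = (((2 * Real.pi) ^ (-(n : ℝ) / 2) : ℝ) : ℂ) *
      𝓕 (ψ : Rn n → ℂ) ((2 * Real.pi)⁻¹ • x) := rfl
  rw [h, Real.fourier_eq']
  congr 1
  refine integral_congr_ae (Filter.Eventually.of_forall fun ξ => ?_)
  simp only [smul_eq_mul]
  congr 2
  have hpi : (-2 * Real.pi * inner ℝ ξ ((2 * Real.pi)⁻¹ • x) : ℝ) = -inner ℝ x ξ := by
    rw [inner_smul_right, real_inner_comm]
    have := Real.pi_ne_zero
    field_simp
  rw [hpi]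
  push_cast
  ring

/-- The convolution `(Ψ * f)(y) = f (Ψ (y - ·))` of a Schwartz function with a tempered
distribution. -/
def conv {n : ℕ} (Ψ : 𝓢(Rn n, ℂ)) (f : 𝓢'(Rn n, ℂ)) (y : Rn n) : ℂ :=
  f (SchwartzMap.compSubConstCLM ℂ y (dilate (-1) (by norm_num) Ψ))

/-- The test function in the definition of `conv` is `x ↦ Ψ (y - x)`. -/
theorem conv_test_apply {n : ℕ} (Ψ : 𝓢(Rn n, ℂ)) (y x : Rn n) :
    SchwartzMap.compSubConstCLM ℂ y (dilate (-1) (by norm_num) Ψ) x = Ψ (y - x) := by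
  simp [dilate_apply]

/-- The Peetre maximal function
`(Ψ_j^* f)_a (x) = sup_y |(Ψ_j * f)(y)| / (1 + |2 ^ j (y - x)| ^ a)`, where `Ψ_j` is the Fourier
transform of `ψ_j`. It may take the value `∞`. -/
def peetre {n : ℕ} (ψ : ℕ → 𝓢(Rn n, ℂ)) (a : ℝ) (f : 𝓢'(Rn n, ℂ)) (j : ℕ) (x : Rn n) : ℝ≥0∞ :=
  ⨆ y : Rn n, ENNReal.ofReal
    (‖conv (fourierHat (ψ j)) f y‖ / (1 + ‖(2 : ℝ) ^ j • (y - x)‖ ^ a))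

/-- The sequence `((Ψ_j^* f)_a w_j)_j`. -/
def weightedPeetre {n : ℕ} (ψ : ℕ → 𝓢(Rn n, ℂ)) (a : ℝ) (w : ℕ → Rn n → ℝ) (f : 𝓢'(Rn n, ℂ))
    (j : ℕ) (x : Rn n) : ℝ≥0∞ :=
  peetre ψ a f j x * ENNReal.ofReal (w j x)

/-- `D^β ψ (0) = 0` for all multi-indices with `|β| < R`: every iterated partial derivative of
`ψ` of order `m < R`, in coordinate directions `i 0, …, i (m - 1)`, vanishes at the origin. -/
def MomentCondition {n : ℕ} (R : ℕ) (ψ : 𝓢(Rn n, ℂ)) : Prop :=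
  ∀ m < R, ∀ i : Fin m → Fin n,
    (∂^{fun l => (EuclideanSpace.single (i l) (1 : ℝ) : Rn n)} ψ) 0 = 0

/-- The Tauberian conditions with parameters `ε` and `k`. -/
def TauberianCondition {n : ℕ} (ε k : ℝ) (φ₀ φ₁ : 𝓢(Rn n, ℂ)) : Prop :=
  (∀ x, ‖x‖ ≤ k * ε → 0 < ‖φ₀ x‖) ∧ (∀ x, ε ≤ ‖x‖ → ‖x‖ ≤ 2 * k * ε → 0 < ‖φ₁ x‖)

end

end VarMorrey

/-!
The Tauberian condition provides `η₀, η₁` with `∑ j ≤ N, η_j φ_j = χ (2 ^ (-N) ·)` and `χ 0 = 1`,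
so that `Ψ_ν * f` is the sum over `j` of the Fourier multipliers with symbols `ψ_ν η_j` applied to
`Φ_j * f`. By Fourier inversion a multiplier is a superposition of translations, and the Peetre
maximal function controls all translates of `Φ_j * f` at a polynomial price; a distribution may be
exchanged with this superposition because it factors, by Hahn–Banach, through finitely many weighted
derivatives. The vanishing moments of `ψ₁` make the symbol of size `2 ^ (-R (ν - j))` for `j ≤ ν`,
and `η₁` being supported away from the origin makes it decay to any order in `2 ^ (j - ν)` for
`j > ν`. As the weights cost only `2 ^ (α₂ (ν - j))` and `α₂ < R`, the weighted maximal functions of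
one system are dominated by a discrete convolution of those of the other with a geometric sequence,
and such convolutions are bounded on `ℓ_q` uniformly in `q ≥ ess inf q > 0`.
-/

namespace VarMorrey

/-- A functional on `[0, ∞]`-valued functions that is monotone up to null sets and homogeneous,
such as the quasi-norm of a solid function space. These are the only properties of the Morrey
quasi-norm that matter for the comparison of Peetre maximal functions. -/
def IsSolid {n : ℕ} (ρ : (Rn n → ℝ≥0∞) → ℝ≥0∞) : Prop :=
  ∀ ⦃c : ℝ≥0∞⦄, c ≠ 0 → c ≠ ∞ → ∀ ⦃f g : Rn n → ℝ≥0∞⦄, (∀ᵐ x, f x ≤ c * g x) → ρ f ≤ c * ρ g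

theorem phi_mono (p : ℝ≥0∞) : Monotone (phi p) := by
  intro s t h
  unfold phi
  split_ifs with _ h₁ h₂ h₂
  · exact le_rfl
  · exact zero_le
  · exact absurd (h.trans h₂) h₁
  · exact le_rfl
  · exact ENNReal.rpow_le_rpow h ENNReal.toReal_nonneg

theorem isSolid_lebesgueNorm {n : ℕ} (p : Rn n → ℝ≥0∞) (B : Set (Rn n)) :
    IsSolid (lebesgueNorm p B) := by
  intro c hc hc' f g h
  unfold lebesgueNorm
  rw [← ENNReal.div_le_iff' hc hc']
  refine le_sInf fun l ⟨hl, hl', hm⟩ => ?_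
  rw [ENNReal.div_le_iff' hc hc']
  refine sInf_le ⟨ENNReal.mul_pos hc hl.ne', ENNReal.mul_lt_top hc'.lt_top hl', le_trans ?_ hm⟩
  refine lintegral_mono_ae (ae_restrict_of_ae (h.mono fun x hx => phi_mono _ ?_))
  calc f x / (c * l) ≤ c * g x / (c * l) := by gcongr
    _ = g x / l := ENNReal.mul_div_mul_left _ _ hc hc'

theorem isSolid_morreyNorm {n : ℕ} (p u : Rn n → ℝ≥0∞) : IsSolid (morreyNorm p u) := by
  intro c hc hc' f g h
  simp only [morreyNorm, ENNReal.mul_iSup, mul_left_comm c]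
  gcongr
  exact isSolid_lebesgueNorm p _ hc hc' h

theorem tsum_pow_natDist_le (s : ℝ≥0∞) (ν : ℕ) :
    ∑' j, s ^ Nat.dist ν j ≤ 2 * (1 - s)⁻¹ := by
  have below : ∑ j ∈ Finset.range ν, s ^ Nat.dist ν j ≤ (1 - s)⁻¹ :=
    calc ∑ j ∈ Finset.range ν, s ^ Nat.dist ν j
        = ∑ j ∈ Finset.range ν, s ^ (j + 1) := by
          rw [← Finset.sum_range_reflect]
          refine Finset.sum_congr rfl fun j hj => ?_
          rw [Finset.mem_range] at hj
          congr 1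
          rw [Nat.dist_eq_sub_of_le_right] <;> omega
      _ ≤ ∑ j ∈ Finset.range (ν + 1), s ^ j := by
          rw [Finset.sum_range_succ']
          exact le_self_add
      _ ≤ (1 - s)⁻¹ := by
          rw [← ENNReal.tsum_geometric]
          exact ENNReal.sum_le_tsum _
  have above : ∑' j, s ^ Nat.dist ν (j + ν) = (1 - s)⁻¹ := by
    rw [← ENNReal.tsum_geometric]
    simp only [Nat.dist_eq_sub_of_le (Nat.le_add_left _ _), Nat.add_sub_cancel]
  rw [← ENNReal.summable.sum_add_tsum_nat_add' (k := ν), above, two_mul]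
  gcongr

theorem iSup_rpow {ι : Type*} (g : ι → ℝ≥0∞) {t : ℝ} (ht : 0 < t) :
    (⨆ i, g i) ^ t = ⨆ i, g i ^ t :=
  (ENNReal.orderIsoRpow t ht).map_iSup g

theorem tsum_iSup_natDist_rpow_le (s : ℝ≥0∞) (g : ℕ → ℝ≥0∞) {t : ℝ} (ht : 0 < t) :
    ∑' ν, (⨆ j, s ^ Nat.dist ν j * g j) ^ t ≤ 2 * (1 - s ^ t)⁻¹ * ∑' j, g j ^ t :=
  calc ∑' ν, (⨆ j, s ^ Nat.dist ν j * g j) ^ t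
      ≤ ∑' ν, ∑' j, (s ^ t) ^ Nat.dist ν j * g j ^ t := by
        gcongr with ν
        rw [iSup_rpow _ ht]
        refine iSup_le fun j => le_trans (le_of_eq ?_) (ENNReal.le_tsum j)
        rw [ENNReal.mul_rpow_of_nonneg _ _ ht.le, ← ENNReal.rpow_natCast, ← ENNReal.rpow_natCast,
          ← ENNReal.rpow_mul, ← ENNReal.rpow_mul, mul_comm t]
    _ = ∑' j, (∑' ν, (s ^ t) ^ Nat.dist j ν) * g j ^ t := by
        rw [ENNReal.tsum_comm]
        simp_rw [ENNReal.tsum_mul_right, Nat.dist_comm]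
    _ ≤ 2 * (1 - s ^ t)⁻¹ * ∑' j, g j ^ t := by
        rw [← ENNReal.tsum_mul_left]
        gcongr with j
        exact tsum_pow_natDist_le _ j

theorem tsum_natDist_le_iSup (s : ℝ≥0∞) (g : ℕ → ℝ≥0∞) (ν : ℕ) :
    ∑' j, (s ^ 2) ^ Nat.dist ν j * g j ≤ 2 * (1 - s)⁻¹ * ⨆ j, s ^ Nat.dist ν j * g j :=
  calc ∑' j, (s ^ 2) ^ Nat.dist ν j * g j
      ≤ ∑' j, s ^ Nat.dist ν j * ⨆ j, s ^ Nat.dist ν j * g j := by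
        refine ENNReal.tsum_le_tsum fun j => ?_
        rw [sq, mul_pow, mul_assoc]
        gcongr
        exact le_iSup (fun j => s ^ Nat.dist ν j * g j) j
    _ ≤ 2 * (1 - s)⁻¹ * ⨆ j, s ^ Nat.dist ν j * g j := by
        rw [ENNReal.tsum_mul_right]
        gcongr
        exact tsum_pow_natDist_le s ν

theorem ellNorm_le_mul {q : ℝ≥0∞} (hq : q ≠ 0) {c : ℝ≥0∞} {f g : ℕ → ℝ≥0∞}
    (h : ∀ j, f j ≤ c * g j) : ellNorm q f ≤ c * ellNorm q g := by
  unfold ellNorm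
  split_ifs with hq'
  · rw [ENNReal.mul_iSup]
    exact iSup_mono h
  · have ht : 0 < q.toReal := ENNReal.toReal_pos hq hq'
    calc (∑' j, f j ^ q.toReal) ^ (1 / q.toReal)
        ≤ (∑' j, (c * g j) ^ q.toReal) ^ (1 / q.toReal) := by gcongr with j; exact h j
      _ = c * (∑' j, g j ^ q.toReal) ^ (1 / q.toReal) := by
        simp_rw [ENNReal.mul_rpow_of_nonneg _ _ ht.le]
        rw [ENNReal.tsum_mul_left, ENNReal.mul_rpow_of_nonneg _ _ (by positivity),
          ← ENNReal.rpow_mul, mul_one_div_cancel ht.ne', ENNReal.rpow_one]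

theorem one_le_two_mul_one_sub_inv (s : ℝ≥0∞) : 1 ≤ 2 * (1 - s)⁻¹ :=
  one_le_mul one_le_two (ENNReal.one_le_inv.2 tsub_le_self)

theorem ellNorm_iSup_natDist_le {s : ℝ≥0∞} (hs : s ≤ 1) {q₀ : NNReal} (hq₀ : 0 < q₀)
    {q : ℝ≥0∞} (hq : q₀ ≤ q) (g : ℕ → ℝ≥0∞) :
    ellNorm q (fun ν => ⨆ j, s ^ Nat.dist ν j * g j) ≤
      (2 * (1 - s ^ (q₀ : ℝ))⁻¹) ^ (1 / (q₀ : ℝ)) * ellNorm q g := by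
  unfold ellNorm
  split_ifs with hq'
  · refine iSup_le fun ν => iSup_le fun j => ?_
    exact mul_le_mul' ((pow_le_one' hs _).trans
      (ENNReal.one_le_rpow (one_le_two_mul_one_sub_inv _) (by positivity))) (le_iSup g j)
  · set t := q.toReal
    have hqt : (q₀ : ℝ) ≤ t := ENNReal.toReal_mono hq' hq
    have ht : 0 < t := hqt.trans_lt' hq₀
    calc (∑' ν, (⨆ j, s ^ Nat.dist ν j * g j) ^ t) ^ (1 / t)
        ≤ (2 * (1 - s ^ t)⁻¹ * ∑' j, g j ^ t) ^ (1 / t) := by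
          gcongr
          exact tsum_iSup_natDist_rpow_le s g ht
      _ = (2 * (1 - s ^ t)⁻¹) ^ (1 / t) * (∑' j, g j ^ t) ^ (1 / t) :=
          ENNReal.mul_rpow_of_nonneg _ _ (by positivity)
      _ ≤ (2 * (1 - s ^ (q₀ : ℝ))⁻¹) ^ (1 / t) * (∑' j, g j ^ t) ^ (1 / t) := by
          gcongr ((2 * (1 - ?_)⁻¹) ^ _) * _
          exact ENNReal.rpow_le_rpow_of_exponent_ge hs hqt
      _ ≤ (2 * (1 - s ^ (q₀ : ℝ))⁻¹) ^ (1 / (q₀ : ℝ)) * (∑' j, g j ^ t) ^ (1 / t) := by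
          gcongr
          exact one_le_two_mul_one_sub_inv _

theorem two_mul_one_sub_inv_ne_top {s : ℝ≥0∞} (hs : s < 1) : 2 * (1 - s)⁻¹ ≠ ∞ :=
  ENNReal.mul_ne_top (by simp) (ENNReal.inv_ne_top.2 (tsub_pos_of_lt hs).ne')

theorem IsSolid.exists_ellNorm_le_of_le_tsum {n : ℕ} {ρ : (Rn n → ℝ≥0∞) → ℝ≥0∞} (hρ : IsSolid ρ)
    {q : Rn n → ℝ≥0∞} (hq : 0 < essInf q volume) {s : ℝ≥0∞} (hs : s < 1) {A : ℝ≥0∞}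
    (hA₀ : A ≠ 0) (hA : A ≠ ∞) :
    ∃ c : ℝ, 0 < c ∧ ∀ g G : ℕ → Rn n → ℝ≥0∞,
      (∀ ν x, G ν x ≤ A * ∑' j, (s ^ 2) ^ Nat.dist ν j * g j x) →
      ρ (fun x => ellNorm (q x) fun j => G j x) ≤
        ENNReal.ofReal c * ρ (fun x => ellNorm (q x) fun j => g j x) := by
  obtain ⟨q₀, hq₀, hq₀q⟩ := ENNReal.lt_iff_exists_nnreal_btwn.1 hq
  rw [ENNReal.coe_pos] at hq₀
  set T : ℝ≥0∞ := 2 * (1 - s)⁻¹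
  set S : ℝ≥0∞ := (2 * (1 - s ^ (q₀ : ℝ))⁻¹) ^ (1 / (q₀ : ℝ))
  have hc : A * T * S ≠ ∞ :=
    ENNReal.mul_ne_top (ENNReal.mul_ne_top hA (two_mul_one_sub_inv_ne_top hs))
      (ENNReal.rpow_ne_top_of_nonneg (by positivity)
        (two_mul_one_sub_inv_ne_top (ENNReal.rpow_lt_one hs (by positivity))))
  have hT : T ≠ 0 := (one_pos.trans_le (one_le_two_mul_one_sub_inv s)).ne'
  have hS : S ≠ 0 := (one_pos.trans_le
    (ENNReal.one_le_rpow (one_le_two_mul_one_sub_inv _) (by positivity))).ne'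
  have hc₀ : A * T * S ≠ 0 := mul_ne_zero (mul_ne_zero hA₀ hT) hS
  refine ⟨(A * T * S).toReal, ENNReal.toReal_pos hc₀ hc, fun g G h => ?_⟩
  rw [ENNReal.ofReal_toReal hc]
  refine hρ hc₀ hc ?_
  filter_upwards [ae_essInf_le (f := q) (μ := volume)] with x hx
  have hqx : (q₀ : ℝ≥0∞) ≤ q x := hq₀q.le.trans hx
  calc ellNorm (q x) (fun ν => G ν x)
      ≤ A * T * ellNorm (q x) (fun ν => ⨆ j, s ^ Nat.dist ν j * g j x) := by
        refine ellNorm_le_mul ((ENNReal.coe_pos.2 hq₀).trans_le hqx).ne' fun ν => (h ν x).trans ?_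
        rw [mul_assoc]
        gcongr
        exact tsum_natDist_le_iSup s (fun j => g j x) ν
    _ ≤ A * T * (S * ellNorm (q x) fun j => g j x) := by
        gcongr
        exact ellNorm_iSup_natDist_le hs.le hq₀ hqx _
    _ = A * T * S * ellNorm (q x) fun j => g j x := (mul_assoc _ _ _).symm

open scoped ContDiff BoundedContinuousFunction

section SchwartzBounds

variable {ι E F : Type*} [NormedAddCommGroup E] [NormedSpace ℝ E]
  [NormedAddCommGroup F] [NormedSpace ℝ F]

/-- The pointwise product of two Schwartz functions. -/
noncomputable def schwartzMul (f g : 𝓢(E, ℂ)) : 𝓢(E, ℂ) :=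
  SchwartzMap.pairing (ContinuousLinearMap.mul ℂ ℂ) f g

@[simp]
theorem schwartzMul_apply (f g : 𝓢(E, ℂ)) (x : E) : schwartzMul f g x = f x * g x :=
  SchwartzMap.pairing_apply_apply _ f g x

/-- The family `g` is `O(θ)` in the Schwartz space, uniformly over the whole index type. -/
def SchwartzBoundedBy (g : ι → 𝓢(E, ℂ)) (θ : ι → ℝ) : Prop :=
  ∀ k l : ℕ, ∃ C : ℝ, 0 ≤ C ∧ ∀ t, SchwartzMap.seminorm ℂ k l (g t) ≤ C * θ t

theorem SchwartzBoundedBy.exists_seminorm_le {g : ι → 𝓢(E, ℂ)} {θ : ι → ℝ}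
    (hg : SchwartzBoundedBy g θ) (hθ : 0 ≤ θ) {q : Seminorm ℂ 𝓢(E, ℂ)} (hq : Continuous q) :
    ∃ C : ℝ, 0 ≤ C ∧ ∀ t, q (g t) ≤ C * θ t := by
  choose K hK hKg using hg
  obtain ⟨s, C, -, hC⟩ := Seminorm.bound_of_continuous (schwartz_withSeminorms ℂ E ℂ) q hq
  have hsum : 0 ≤ ∑ m ∈ s, K m.1 m.2 := Finset.sum_nonneg fun m _ => hK _ _
  have hsup (t : ι) : s.sup (schwartzSeminormFamily ℂ E ℂ) (g t) ≤ (∑ m ∈ s, K m.1 m.2) * θ t := by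
    refine Seminorm.finset_sup_apply_le (mul_nonneg hsum (hθ t)) fun m hm => ?_
    refine (hKg m.1 m.2 t).trans (mul_le_mul_of_nonneg_right ?_ (hθ t))
    exact Finset.single_le_sum (f := fun m : ℕ × ℕ => K m.1 m.2) (fun m _ => hK _ _) hm
  refine ⟨C * ∑ m ∈ s, K m.1 m.2, mul_nonneg C.2 hsum, fun t => (hC (g t)).trans ?_⟩
  rw [mul_assoc]
  exact mul_le_mul_of_nonneg_left (hsup t) C.2

theorem SchwartzBoundedBy.tendsto_zero {g : ι → 𝓢(E, ℂ)} {θ : ι → ℝ}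
    (hg : SchwartzBoundedBy g θ) {L : Filter ι} (hθ : Filter.Tendsto θ L (nhds 0)) :
    Filter.Tendsto g L (nhds 0) := by
  rw [(schwartz_withSeminorms ℂ E ℂ).tendsto_nhds]
  rintro ⟨k, l⟩ ε hε
  obtain ⟨C, -, hCg⟩ := hg k l
  have hlim : Filter.Tendsto (fun t => C * θ t) L (nhds 0) := by simpa using hθ.const_mul C
  filter_upwards [hlim.eventually_lt_const hε] with t ht
  rw [sub_zero]
  exact (hCg t).trans_lt ht

theorem exists_one_add_norm_pow_mul_le (f : 𝓢(E, F)) (k l : ℕ) :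
    ∃ C : ℝ, 0 ≤ C ∧ ∀ x, (1 + ‖x‖) ^ k * ‖iteratedFDeriv ℝ l f x‖ ≤ C :=
  ⟨_, by positivity, fun x =>
    SchwartzMap.one_add_le_sup_seminorm_apply (𝕜 := ℝ) (m := (k, l)) le_rfl le_rfl f x⟩

theorem schwartzBoundedBy_of_eq_mul {h : ι → E → ℂ} {η : 𝓢(E, ℂ)} {g : ι → 𝓢(E, ℂ)}
    {θ : ι → ℝ} (hg : ∀ t x, g t x = h t x * η x) (hh : ∀ t, ContDiff ℝ ∞ (h t)) (hθ : 0 ≤ θ)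
    (hb : ∀ i : ℕ, ∃ (A : ℝ) (B : ℕ), 0 ≤ A ∧ ∀ t, ∀ x ∈ tsupport η,
      ‖iteratedFDeriv ℝ i (h t) x‖ ≤ A * θ t * (1 + ‖x‖) ^ B) :
    SchwartzBoundedBy g θ := by
  intro k l
  choose A B hA hAB using hb
  choose K hK hKη using fun i => exists_one_add_norm_pow_mul_le η (B i + k) (l - i)
  have hC : 0 ≤ ∑ i ∈ Finset.range (l + 1), (l.choose i : ℝ) * A i * K i :=
    Finset.sum_nonneg fun i _ => mul_nonneg (mul_nonneg (by positivity) (hA i)) (hK i)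
  have leibniz_term (t : ι) (x : E) (i : ℕ) :
      ‖x‖ ^ k * (l.choose i * ‖iteratedFDeriv ℝ i (h t) x‖ * ‖iteratedFDeriv ℝ (l - i) η x‖) ≤
        l.choose i * A i * K i * θ t := by
    have := hA i
    have := hK i
    have : 0 ≤ θ t := hθ t
    by_cases hx : x ∈ tsupport η
    · calc ‖x‖ ^ k * (l.choose i * ‖iteratedFDeriv ℝ i (h t) x‖ * ‖iteratedFDeriv ℝ (l - i) η x‖)
          ≤ (1 + ‖x‖) ^ k *
            (l.choose i * (A i * θ t * (1 + ‖x‖) ^ B i) * ‖iteratedFDeriv ℝ (l - i) η x‖) := by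
            gcongr
            · linarith
            · exact hAB i t x hx
        _ = l.choose i * A i * ((1 + ‖x‖) ^ (B i + k) * ‖iteratedFDeriv ℝ (l - i) η x‖) * θ t := by
            rw [pow_add]; ring
        _ ≤ l.choose i * A i * K i * θ t := by
            gcongr
            exact hKη i x
    · rw [show iteratedFDeriv ℝ (l - i) η x = 0 from
        not_not.1 fun h0 => hx (support_iteratedFDeriv_subset (l - i) h0), norm_zero]
      simp only [mul_zero]
      positivity
  refine ⟨_, hC, fun t => SchwartzMap.seminorm_le_bound ℂ k l _ (mul_nonneg hC (hθ t)) fun x => ?_⟩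
  rw [show (g t : E → ℂ) = fun x => h t x * η x from funext (hg t)]
  grw [norm_iteratedFDeriv_mul_le (hh t) (η.smooth ⊤) x (n := l) (by exact_mod_cast le_top)]
  rw [Finset.mul_sum, Finset.sum_mul]
  exact Finset.sum_le_sum fun i _ => leibniz_term t x i

theorem norm_iteratedFDeriv_comp_smul {f : E → F} (hf : ContDiff ℝ ∞ f) (i : ℕ) {t : ℝ}
    (ht : 0 ≤ t) (x : E) :
    ‖iteratedFDeriv ℝ i (fun y => f (t • y)) x‖ = t ^ i * ‖iteratedFDeriv ℝ i f (t • x)‖ := by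
  rw [iteratedFDeriv_comp_const_smul t (hf.of_le (by exact_mod_cast le_top)), norm_smul, norm_pow,
    Real.norm_of_nonneg ht]

theorem contDiff_comp_smul {f : E → F} (hf : ContDiff ℝ ∞ f) (t : ℝ) :
    ContDiff ℝ ∞ fun x => f (t • x) :=
  hf.comp (contDiff_const_smul t)

theorem norm_iteratedFDeriv_le_of_forall_eq_zero {f : E → F} (hf : ContDiff ℝ ∞ f) {R : ℕ}
    (h : ∀ m < R, iteratedFDeriv ℝ m f 0 = 0) {C : ℝ} (hC : ∀ x, ‖iteratedFDeriv ℝ R f x‖ ≤ C)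
    {m : ℕ} (hm : m ≤ R) (x : E) : ‖iteratedFDeriv ℝ (R - m) f x‖ ≤ C * ‖x‖ ^ m := by
  have hdiff (i : ℕ) : Differentiable ℝ (iteratedFDeriv ℝ i f) :=
    hf.differentiable_iteratedFDeriv (mod_cast ENat.natCast_lt_top i)
  induction m generalizing x with
  | zero => simpa using hC x
  | succ m ih =>
    have hderiv : ∀ y ∈ Metric.closedBall (0 : E) ‖x‖,
        ‖fderiv ℝ (iteratedFDeriv ℝ (R - (m + 1)) f) y‖ ≤ C * ‖x‖ ^ m := fun y hy => by
      rw [norm_fderiv_iteratedFDeriv, show R - (m + 1) + 1 = R - m by omega]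
      refine (ih (by omega) y).trans ?_
      have := (norm_nonneg _).trans (hC 0)
      gcongr
      simpa using hy
    have := (convex_closedBall (0 : E) ‖x‖).norm_image_sub_le_of_norm_fderiv_le
      (fun y _ => (hdiff _).differentiableAt)
      hderiv (Metric.mem_closedBall_self (norm_nonneg x)) (y := x) (by simp)
    rwa [h _ (by omega), sub_zero, sub_zero, mul_assoc, ← pow_succ] at this

theorem schwartzBoundedBy_comp_smul_mul_of_le_one {f : E → ℂ} (hf : ContDiff ℝ ∞ f)
    (hfb : ∀ i : ℕ, ∃ C, ∀ x, ‖iteratedFDeriv ℝ i f x‖ ≤ C) {R : ℕ}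
    (hf₀ : ∀ m < R, iteratedFDeriv ℝ m f 0 = 0) {τ : ι → ℝ} (hτ : ∀ t, τ t ∈ Set.Ioc 0 1)
    {η : 𝓢(E, ℂ)} {g : ι → 𝓢(E, ℂ)} (hg : ∀ t x, g t x = f (τ t • x) * η x) :
    SchwartzBoundedBy g fun t => τ t ^ R := by
  refine schwartzBoundedBy_of_eq_mul hg (fun t => contDiff_comp_smul hf _)
    (fun t => pow_nonneg (hτ t).1.le R) fun i => ?_
  rcases le_total i R with hi | hi
  · obtain ⟨C, hC⟩ := hfb R
    refine ⟨C, R - i, (norm_nonneg _).trans (hC 0), fun t x _ => ?_⟩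
    have ht := (hτ t).1.le
    have hC₀ := (norm_nonneg _).trans (hC 0)
    have taylor := norm_iteratedFDeriv_le_of_forall_eq_zero hf hf₀ hC (R.sub_le i) (τ t • x)
    rw [Nat.sub_sub_self hi, norm_smul, Real.norm_of_nonneg ht] at taylor
    calc ‖iteratedFDeriv ℝ i (fun y => f (τ t • y)) x‖
        = τ t ^ i * ‖iteratedFDeriv ℝ i f (τ t • x)‖ := norm_iteratedFDeriv_comp_smul hf i ht x
      _ ≤ τ t ^ i * (C * (τ t * ‖x‖) ^ (R - i)) := by gcongr
      _ = C * τ t ^ (i + (R - i)) * ‖x‖ ^ (R - i) := by rw [mul_pow, pow_add]; ring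
      _ ≤ C * τ t ^ R * (1 + ‖x‖) ^ (R - i) := by
        rw [Nat.add_sub_cancel' hi]
        gcongr
        linarith
  · obtain ⟨C, hC⟩ := hfb i
    refine ⟨C, 0, (norm_nonneg _).trans (hC 0), fun t x _ => ?_⟩
    have ht := (hτ t).1.le
    rw [norm_iteratedFDeriv_comp_smul hf i ht, pow_zero, mul_one, mul_comm]
    exact mul_le_mul (hC _) (pow_le_pow_of_le_one ht (hτ t).2 hi) (by positivity)
      ((norm_nonneg _).trans (hC 0))

theorem schwartzBoundedBy_comp_smul_mul_of_one_le (ψ : 𝓢(E, ℂ)) (N : ℕ) {τ : ι → ℝ}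
    (hτ : ∀ t, 1 ≤ τ t) {η : 𝓢(E, ℂ)} {ρ : ℝ} (hρ : 0 < ρ) (hη : ∀ x ∈ tsupport η, ρ ≤ ‖x‖)
    {g : ι → 𝓢(E, ℂ)} (hg : ∀ t x, g t x = ψ (τ t • x) * η x) :
    SchwartzBoundedBy g fun t => (τ t ^ N)⁻¹ := by
  have hτ₀ (t : ι) : 0 < τ t := one_pos.trans_le (hτ t)
  refine schwartzBoundedBy_of_eq_mul hg (fun t => contDiff_comp_smul (ψ.smooth ⊤) _)
    (fun t => inv_nonneg.2 (pow_nonneg (hτ₀ t).le N)) fun i => ?_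
  refine ⟨SchwartzMap.seminorm ℝ (i + N) i ψ / ρ ^ (i + N), 0, by positivity, fun t x hx => ?_⟩
  have ht := hτ₀ t
  rw [norm_iteratedFDeriv_comp_smul (ψ.smooth ⊤) i ht.le, pow_zero, mul_one, ← div_eq_mul_inv,
    div_div, le_div_iff₀ (by positivity)]
  calc τ t ^ i * ‖iteratedFDeriv ℝ i ψ (τ t • x)‖ * (ρ ^ (i + N) * τ t ^ N)
      = (τ t * ρ) ^ (i + N) * ‖iteratedFDeriv ℝ i ψ (τ t • x)‖ := by
        rw [mul_pow, pow_add (τ t)]; ring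
    _ ≤ (τ t * ‖x‖) ^ (i + N) * ‖iteratedFDeriv ℝ i ψ (τ t • x)‖ := by
        gcongr
        exact hη x hx
    _ = ‖τ t • x‖ ^ (i + N) * ‖iteratedFDeriv ℝ i ψ (τ t • x)‖ := by
        rw [norm_smul, Real.norm_of_nonneg ht.le]
    _ ≤ SchwartzMap.seminorm ℝ (i + N) i ψ := ψ.le_seminorm ℝ (i + N) i (τ t • x)

theorem exists_norm_iteratedFDeriv_sub_const_le (χ : 𝓢(E, F)) (c : F) (i : ℕ) :
    ∃ C, ∀ x, ‖iteratedFDeriv ℝ i (fun y => χ y - c) x‖ ≤ C := by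
  refine ⟨SchwartzMap.seminorm ℝ 0 i χ + ‖c‖, fun x => ?_⟩
  have hconst : ‖iteratedFDeriv ℝ i (fun _ : E => c) x‖ ≤ ‖c‖ := by
    rcases eq_or_ne i 0 with rfl | hi
    · rw [norm_iteratedFDeriv_zero]
    · simp [iteratedFDeriv_const_of_ne hi]
  change ‖iteratedFDeriv ℝ i ((χ : E → F) - fun _ => c) x‖ ≤ _
  rw [iteratedFDeriv_sub_apply (χ.smooth i).contDiffAt contDiffAt_const]
  exact (norm_sub_le _ _).trans (add_le_add (χ.norm_iteratedFDeriv_le_seminorm ℝ i x) hconst)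

theorem tendsto_of_eq_cutoff_mul {χ ψ : 𝓢(E, ℂ)} (hχ : χ 0 = 1) {τ : ι → ℝ}
    (hτ : ∀ t, τ t ∈ Set.Ioc 0 1) {L : Filter ι} (hτL : Filter.Tendsto τ L (nhds 0))
    {g : ι → 𝓢(E, ℂ)} (hg : ∀ t x, g t x = χ (τ t • x) * ψ x) :
    Filter.Tendsto g L (nhds ψ) := by
  have hχ₀ : ∀ m < 1, iteratedFDeriv ℝ m (fun y => χ y - 1) 0 = 0 := fun m hm => by
    rw [Nat.lt_one_iff.1 hm, iteratedFDeriv_zero_eq_comp, Function.comp_apply, hχ, sub_self,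
      map_zero]
  have hbound : SchwartzBoundedBy (fun t => g t - ψ) fun t => τ t ^ 1 :=
    schwartzBoundedBy_comp_smul_mul_of_le_one ((χ.smooth ⊤).sub contDiff_const)
      (exists_norm_iteratedFDeriv_sub_const_le χ 1) hχ₀ hτ
      fun t x => by rw [sub_apply, hg, sub_mul, one_mul]
  rw [← tendsto_sub_nhds_zero_iff]
  exact hbound.tendsto_zero (by simpa using hτL)

theorem exists_lintegral_mul_one_add_norm_rpow_le [MeasurableSpace E] [BorelSpace E]
    [FiniteDimensional ℝ E] (μ : Measure E) [μ.HasTemperateGrowth] (a : ℝ) :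
    ∃ q : Seminorm ℂ 𝓢(E, ℂ), Continuous q ∧ ∀ g : 𝓢(E, ℂ),
      ∫⁻ z, ‖g z‖ₑ * ENNReal.ofReal ((1 + ‖z‖) ^ a) ∂μ ≤ ENNReal.ofReal (q g) := by
  set A := ⌈a⌉₊
  set M := μ.integrablePower
  set p : Seminorm ℂ 𝓢(E, ℂ) := (Finset.Iic (A + M, 0)).sup (schwartzSeminormFamily ℂ E ℂ)
  have hp : Continuous p :=
    Seminorm.continuous_of_le (Seminorm.continuous_finsetSum fun i _ =>
      (schwartz_withSeminorms ℂ E ℂ).continuous_seminorm i) (Seminorm.finset_sup_le_sum _ _)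
  have hpoint (g : 𝓢(E, ℂ)) (z : E) :
      ‖g z‖ * (1 + ‖z‖) ^ a ≤ 2 ^ (A + M) * p g * (1 + ‖z‖) ^ (-(M : ℝ)) := by
    have hz : 1 ≤ 1 + ‖z‖ := by linarith [norm_nonneg z]
    have hdecay := SchwartzMap.one_add_le_sup_seminorm_apply (𝕜 := ℂ) (m := (A + M, 0))
      (k := A + M) (n := 0) le_rfl le_rfl g z
    rw [norm_iteratedFDeriv_zero] at hdecay
    rw [Real.rpow_neg (by positivity), Real.rpow_natCast, ← div_eq_mul_inv,
      le_div_iff₀ (by positivity)]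
    calc ‖g z‖ * (1 + ‖z‖) ^ a * (1 + ‖z‖) ^ M
        ≤ ‖g z‖ * (1 + ‖z‖) ^ (A : ℝ) * (1 + ‖z‖) ^ M := by
          gcongr
          exact Nat.le_ceil a
      _ = (1 + ‖z‖) ^ (A + M) * ‖g z‖ := by rw [Real.rpow_natCast, pow_add]; ring
      _ ≤ 2 ^ (A + M) * p g := hdecay
  have hint := Measure.integrable_pow_neg_integrablePower μ
  set I : NNReal := ⟨∫ z : E, (1 + ‖z‖) ^ (-(M : ℝ)) ∂μ, integral_nonneg fun z => by positivity⟩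
  refine ⟨(2 ^ (A + M) * I) • p, hp.const_smul _, fun g => ?_⟩
  calc ∫⁻ z, ‖g z‖ₑ * ENNReal.ofReal ((1 + ‖z‖) ^ a) ∂μ
      ≤ ∫⁻ z, ENNReal.ofReal (2 ^ (A + M) * p g * (1 + ‖z‖) ^ (-(M : ℝ))) ∂μ := by
        refine lintegral_mono fun z => ?_
        rw [← ofReal_norm, ← ENNReal.ofReal_mul (norm_nonneg _)]
        exact ENNReal.ofReal_le_ofReal (hpoint g z)
    _ = ENNReal.ofReal (∫ z, 2 ^ (A + M) * p g * (1 + ‖z‖) ^ (-(M : ℝ)) ∂μ) := by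
        rw [ofReal_integral_eq_lintegral_ofReal (hint.const_mul _)]
        exact Filter.Eventually.of_forall fun z =>
          mul_nonneg (mul_nonneg (by positivity) (apply_nonneg _ _)) (by positivity)
    _ = ENNReal.ofReal (((2 ^ (A + M) * I) • p) g) := by
        rw [integral_const_mul, mul_right_comm]
        rfl

end SchwartzBounds

/-- Bounded continuous functions with values in a normed group `F`. The abbreviation makes
instance search use the metric of `F` that comes from its norm; for spaces of multilinear maps it
would otherwise find a different one that is not reducibly equal to it. -/
abbrev BddCont (X F : Type*) [TopologicalSpace X] [NormedAddCommGroup F] := X →ᵇ F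

section Jets

variable {E : Type*} [NormedAddCommGroup E] [NormedSpace ℝ E]

/-- The map `f ↦ (x ↦ ‖x‖ ^ k D^l f(x))` into bounded continuous functions. -/
noncomputable def weightedJet (k l : ℕ) : 𝓢(E, ℂ) →ₗ[ℂ] BddCont E (E [×l]→L[ℝ] ℂ) where
  toFun f := BoundedContinuousFunction.ofNormedAddCommGroup
    (fun x => ‖x‖ ^ k • iteratedFDeriv ℝ l f x)
    ((continuous_norm.pow k).smul ((f.smooth ⊤).continuous_iteratedFDeriv
      (by exact_mod_cast le_top)))
    (SchwartzMap.seminorm ℝ k l f) fun x => by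
      rw [norm_smul, norm_pow, norm_norm]
      exact f.le_seminorm ℝ k l x
  map_add' f g := by
    ext1 x
    change ‖x‖ ^ k • iteratedFDeriv ℝ l ((f : E → ℂ) + (g : E → ℂ)) x = ‖x‖ ^ k • _ + ‖x‖ ^ k • _
    rw [iteratedFDeriv_add_apply (f.contDiffAt l) (g.contDiffAt l), smul_add]
  map_smul' c f := by
    ext1 x
    change ‖x‖ ^ k • iteratedFDeriv ℝ l (c • (f : E → ℂ)) x = c • ‖x‖ ^ k • _
    rw [iteratedFDeriv_const_smul_apply (f.contDiffAt l), smul_comm]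

theorem weightedJet_apply (k l : ℕ) (f : 𝓢(E, ℂ)) (x : E) :
    weightedJet k l f x = ‖x‖ ^ k • iteratedFDeriv ℝ l f x := rfl

theorem seminorm_le_norm_weightedJet (k l : ℕ) (f : 𝓢(E, ℂ)) :
    SchwartzMap.seminorm ℂ k l f ≤ ‖weightedJet k l f‖ := by
  refine SchwartzMap.seminorm_le_bound ℂ k l f (norm_nonneg _) fun x => ?_
  have := (weightedJet k l f).norm_coe_le_norm x
  rwa [weightedJet_apply, norm_smul, norm_pow, norm_norm] at this

theorem iteratedFDeriv_compSubConstCLM (l : ℕ) (f : 𝓢(E, ℂ)) (z x : E) :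
    iteratedFDeriv ℝ l (SchwartzMap.compSubConstCLM ℂ z f) x = iteratedFDeriv ℝ l f (x - z) :=
  iteratedFDeriv_comp_sub l z x

theorem exists_norm_pow_mul_iteratedFDeriv_sub_le (f : 𝓢(E, ℂ)) (k l : ℕ) :
    ∃ C : ℝ, 0 ≤ C ∧ ∀ x z, ‖x‖ ^ k * ‖iteratedFDeriv ℝ l f (x - z)‖ ≤ C * (1 + ‖z‖) ^ k := by
  obtain ⟨C, hC, h⟩ := exists_one_add_norm_pow_mul_le f k l
  refine ⟨C, hC, fun x z => ?_⟩
  have hx : ‖x‖ ≤ (1 + ‖x - z‖) * (1 + ‖z‖) := by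
    have := norm_sub_norm_le x z
    nlinarith [norm_nonneg z, norm_nonneg (x - z)]
  calc ‖x‖ ^ k * ‖iteratedFDeriv ℝ l f (x - z)‖
      ≤ ((1 + ‖x - z‖) * (1 + ‖z‖)) ^ k * ‖iteratedFDeriv ℝ l f (x - z)‖ := by gcongr
    _ = ((1 + ‖x - z‖) ^ k * ‖iteratedFDeriv ℝ l f (x - z)‖) * (1 + ‖z‖) ^ k := by
        rw [mul_pow]; ring
    _ ≤ _ := by gcongr; exact h _

theorem exists_norm_weightedJet_translate_le (f : 𝓢(E, ℂ)) (k l : ℕ) :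
    ∃ C : ℝ, 0 ≤ C ∧
      ∀ z, ‖weightedJet k l (SchwartzMap.compSubConstCLM ℂ z f)‖ ≤ C * (1 + ‖z‖) ^ k := by
  obtain ⟨C, hC, h⟩ := exists_norm_pow_mul_iteratedFDeriv_sub_le f k l
  refine ⟨C, hC, fun z => (BoundedContinuousFunction.norm_le (by positivity)).2 fun x => ?_⟩
  rw [weightedJet_apply, norm_smul, norm_pow, norm_norm, iteratedFDeriv_compSubConstCLM]
  exact h x z

theorem norm_smul_comp_sub_le {F : Type*} [NormedAddCommGroup F] [NormedSpace ℝ F] {T : E → F}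
    (hT : Differentiable ℝ T) {c K r : ℝ} (hc : 0 ≤ c) {x z z₀ : E}
    (hK : ∀ ζ ∈ Metric.ball z₀ r, c * ‖fderiv ℝ T (x - ζ)‖ ≤ K) (hz : z ∈ Metric.ball z₀ r) :
    ‖c • T (x - z) - c • T (x - z₀)‖ ≤ K * ‖z - z₀‖ := by
  refine (convex_ball z₀ r).norm_image_sub_le_of_norm_hasFDerivWithin_le (𝕜 := ℝ)
    (f := fun ζ => c • T (x - ζ)) (f' := fun ζ => c • (-fderiv ℝ T (x - ζ)))
    (fun ζ _ => ?_) (fun ζ hζ => ?_)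
    (Metric.mem_ball_self (Metric.pos_of_mem_ball hz)) hz
  · have := ((hT (x - ζ)).hasFDerivAt.comp ζ ((hasFDerivAt_id ζ).const_sub x)).const_smul c
    rw [ContinuousLinearMap.comp_neg, ContinuousLinearMap.comp_id] at this
    exact this.hasFDerivWithinAt
  · rw [norm_smul, norm_neg, Real.norm_of_nonneg hc]
    exact hK ζ hζ

theorem continuous_weightedJet_translate (f : 𝓢(E, ℂ)) (k l : ℕ) :
    Continuous fun z => weightedJet k l (SchwartzMap.compSubConstCLM ℂ z f) := by
  obtain ⟨C, hC, h⟩ := exists_norm_pow_mul_iteratedFDeriv_sub_le f k (l + 1)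
  refine continuous_iff_continuousAt.2 fun z₀ => ?_
  set K := C * (2 + ‖z₀‖) ^ k
  have : 0 ≤ K := by positivity
  refine continuousAt_of_locally_lipschitz (r := 1) one_pos K fun z hz => ?_
  rw [dist_eq_norm, dist_eq_norm, ← map_sub]
  refine (BoundedContinuousFunction.norm_le (by positivity)).2 fun x => ?_
  rw [map_sub, BoundedContinuousFunction.sub_apply, weightedJet_apply, weightedJet_apply,
    iteratedFDeriv_compSubConstCLM, iteratedFDeriv_compSubConstCLM]
  refine norm_smul_comp_sub_le ((f.smooth ⊤).differentiable_iteratedFDeriv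
    (mod_cast ENat.natCast_lt_top l)) (by positivity) (fun ζ hζ => ?_) hz
  rw [norm_fderiv_iteratedFDeriv]
  refine (h x ζ).trans ?_
  have hζ' : ‖ζ‖ ≤ 1 + ‖z₀‖ := by
    have := norm_sub_norm_le ζ z₀
    rw [mem_ball_iff_norm] at hζ
    linarith
  simp only [K]
  gcongr C * ?_ ^ k
  linarith

theorem exists_strongDual_comp_eq {𝕜 M G : Type*} [RCLike 𝕜] [AddCommGroup M] [Module 𝕜 M]
    [SeminormedAddCommGroup G] [NormedSpace 𝕜 G] (J : M →ₗ[𝕜] G) (F : M →ₗ[𝕜] 𝕜) {C : ℝ}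
    (h : ∀ φ, ‖F φ‖ ≤ C * ‖J φ‖) : ∃ L : StrongDual 𝕜 G, ∀ φ, L (J φ) = F φ := by
  have hker : LinearMap.ker J ≤ LinearMap.ker F := fun φ hφ => by
    have := h φ
    rw [LinearMap.mem_ker.1 hφ, norm_zero, mul_zero] at this
    exact norm_le_zero_iff.1 this
  obtain ⟨f, rfl⟩ : F ∈ LinearMap.range J.dualMap := by
    rw [LinearMap.range_dualMap_eq_dualAnnihilator_ker]
    exact (Submodule.mem_dualAnnihilator F).2 hker
  have hf : ∀ y : LinearMap.range J, ‖f.domRestrict (LinearMap.range J) y‖ ≤ C * ‖y‖ := by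
    rintro ⟨_, φ, rfl⟩
    exact h φ
  obtain ⟨L, hL, -⟩ := exists_extension_norm_eq (LinearMap.range J)
    ((f.domRestrict (LinearMap.range J)).mkContinuous C hf)
  exact ⟨L, fun φ => hL ⟨J φ, LinearMap.mem_range_self J φ⟩⟩

theorem exists_strongDual_weightedJet (F : 𝓢(E, ℂ) →L[ℂ] ℂ) :
    ∃ (s : Finset (ℕ × ℕ)) (L : StrongDual ℂ ((i : s) → BddCont E (E [×i.1.2]→L[ℝ] ℂ))),
      ∀ φ, L (fun i => weightedJet i.1.1 i.1.2 φ) = F φ := by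
  obtain ⟨s, C, -, hC⟩ := Seminorm.bound_of_continuous (schwartz_withSeminorms ℂ E ℂ)
    ((normSeminorm ℂ ℂ).comp (F : 𝓢(E, ℂ) →ₗ[ℂ] ℂ)) (continuous_norm.comp F.continuous)
  let J : 𝓢(E, ℂ) →ₗ[ℂ] ((i : s) → BddCont E (E [×i.1.2]→L[ℝ] ℂ)) :=
    LinearMap.pi fun i => weightedJet i.1.1 i.1.2
  have hJ (φ : 𝓢(E, ℂ)) : s.sup (schwartzSeminormFamily ℂ E ℂ) φ ≤ ‖J φ‖ :=
    Seminorm.finset_sup_apply_le (norm_nonneg _) fun i hi =>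
      (seminorm_le_norm_weightedJet i.1 i.2 φ).trans (norm_le_pi_norm (J φ) ⟨i, hi⟩)
  exact ⟨s, exists_strongDual_comp_eq J F fun φ =>
    (hC φ).trans (mul_le_mul_of_nonneg_left (hJ φ) C.2)⟩

theorem apply_eq_integral_of_weightedJet_eq_integral {α : Type*} [MeasurableSpace α]
    {μ : Measure α} {h : α → 𝓢(E, ℂ)} {H : 𝓢(E, ℂ)}
    (hint : ∀ k l, Integrable (fun z => weightedJet k l (h z)) μ)
    (hH : ∀ k l, weightedJet k l H = ∫ z, weightedJet k l (h z) ∂μ) (F : 𝓢(E, ℂ) →L[ℂ] ℂ) :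
    F H = ∫ z, F (h z) ∂μ := by
  obtain ⟨s, L, hL⟩ := exists_strongDual_weightedJet F
  have hH' : (fun i : s => weightedJet i.1.1 i.1.2 H) =
      ∫ z, (fun i : s => weightedJet i.1.1 i.1.2 (h z)) ∂μ := by
    funext i
    rw [eval_integral fun i : s => hint i.1.1 i.1.2, hH]
  rw [← hL, hH', ← L.integral_comp_comm (Integrable.of_eval fun i : s => hint i.1.1 i.1.2)]
  simp only [hL]

end Jets

section Convolution

variable {V : Type*} [NormedAddCommGroup V] [InnerProductSpace ℝ V] [FiniteDimensional ℝ V]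
  [MeasurableSpace V] [BorelSpace V]

/-- The convolution of two Schwartz functions. -/
noncomputable def schwartzConv (f g : 𝓢(V, ℂ)) : 𝓢(V, ℂ) :=
  SchwartzMap.convolution (ContinuousLinearMap.mul ℂ ℂ) f g

theorem schwartzConv_apply (f g : 𝓢(V, ℂ)) (x : V) :
    schwartzConv f g x = ∫ z, f z * g (x - z) :=
  SchwartzMap.convolution_apply (ContinuousLinearMap.mul ℂ ℂ) f g x

theorem fourier_schwartzConv (f g : 𝓢(V, ℂ)) :
    𝓕 (schwartzConv f g) = schwartzMul (𝓕 f) (𝓕 g) :=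
  SchwartzMap.fourier_convolution (ContinuousLinearMap.mul ℂ ℂ) f g

theorem fourier_injective : Function.Injective (𝓕 : 𝓢(V, ℂ) → 𝓢(V, ℂ)) := fun f g h => by
  simpa using congrArg (𝓕⁻ : 𝓢(V, ℂ) → 𝓢(V, ℂ)) h

theorem lineDerivOp_schwartzConv (f g : 𝓢(V, ℂ)) (m : V) :
    ∂_{m} (schwartzConv f g) = schwartzConv f (∂_{m} g) := by
  apply fourier_injective
  rw [SchwartzMap.fourier_lineDerivOp_eq, fourier_schwartzConv, fourier_schwartzConv,
    SchwartzMap.fourier_lineDerivOp_eq]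
  have hm : (fun x : V => inner ℝ x m).HasTemperateGrowth :=
    Function.hasTemperateGrowth_inner_left m
  ext x
  simp only [smul_apply, SchwartzMap.smulLeftCLM_apply_apply hm, schwartzMul_apply,
    smul_eq_mul, Complex.real_smul]
  ring

theorem iteratedLineDerivOp_schwartzConv (f g : 𝓢(V, ℂ)) {l : ℕ} (m : Fin l → V) :
    ∂^{m} (schwartzConv f g) = schwartzConv f (∂^{m} g) := by
  induction l with
  | zero => rfl
  | succ l ih =>
    rw [LineDeriv.iteratedLineDerivOp_succ_left, ih, lineDerivOp_schwartzConv]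
    rfl

theorem integrable_weightedJet_smul_translate (f g : 𝓢(V, ℂ)) (k l : ℕ) :
    Integrable fun z => weightedJet k l (f z • SchwartzMap.compSubConstCLM ℂ z g) := by
  set M := (volume : Measure V).integrablePower
  obtain ⟨C, hC, hCz⟩ := exists_norm_weightedJet_translate_le g k l
  obtain ⟨D, -, hDz⟩ := exists_one_add_norm_pow_mul_le f (k + M) 0
  have hcont : Continuous fun z => weightedJet k l (f z • SchwartzMap.compSubConstCLM ℂ z g) := by
    simp only [map_smul]
    exact f.continuous.smul (continuous_weightedJet_translate g k l)
  refine ((Measure.integrable_pow_neg_integrablePower volume).const_mul (C * D)).mono'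
    hcont.aestronglyMeasurable (Filter.Eventually.of_forall fun z => ?_)
  have hf := hDz z
  rw [norm_iteratedFDeriv_zero, pow_add] at hf
  rw [map_smul, norm_smul, Real.rpow_neg (by positivity), Real.rpow_natCast, ← div_eq_mul_inv,
    le_div_iff₀ (by positivity)]
  calc ‖f z‖ * ‖weightedJet k l (SchwartzMap.compSubConstCLM ℂ z g)‖ * (1 + ‖z‖) ^ M
      ≤ ‖f z‖ * (C * (1 + ‖z‖) ^ k) * (1 + ‖z‖) ^ M := by gcongr; exact hCz z
    _ = C * ((1 + ‖z‖) ^ k * (1 + ‖z‖) ^ M * ‖f z‖) := by ring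
    _ ≤ C * D := by gcongr

theorem weightedJet_schwartzConv (f g : 𝓢(V, ℂ)) (k l : ℕ) :
    weightedJet k l (schwartzConv f g) =
      ∫ z, weightedJet k l (f z • SchwartzMap.compSubConstCLM ℂ z g) := by
  ext1 x
  ext1 m
  let e : BddCont V (V [×l]→L[ℝ] ℂ) →L[ℝ] ℂ :=
    (ContinuousMultilinearMap.apply ℝ (fun _ : Fin l => V) ℂ m).comp
      (BoundedContinuousFunction.evalCLM ℝ x)
  have he (z : V) : e (weightedJet k l (f z • SchwartzMap.compSubConstCLM ℂ z g)) =
      ‖x‖ ^ k • (f z * (∂^{m} g) (x - z)) := by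
    rw [map_smul]
    change (f z • ‖x‖ ^ k • iteratedFDeriv ℝ l (SchwartzMap.compSubConstCLM ℂ z g) x) m = _
    rw [iteratedFDeriv_compSubConstCLM, SchwartzMap.iteratedLineDerivOp_eq_iteratedFDeriv,
      smul_comm]
    rfl
  calc weightedJet k l (schwartzConv f g) x m
      = ‖x‖ ^ k • (∂^{m} (schwartzConv f g)) x := by
        rw [SchwartzMap.iteratedLineDerivOp_eq_iteratedFDeriv]
        rfl
    _ = ∫ z, e (weightedJet k l (f z • SchwartzMap.compSubConstCLM ℂ z g)) := by
        simp_rw [he]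
        rw [iteratedLineDerivOp_schwartzConv, schwartzConv_apply, integral_smul]
    _ = _ := e.integral_comp_comm (integrable_weightedJet_smul_translate f g k l)

theorem apply_schwartzConv (F : 𝓢(V, ℂ) →L[ℂ] ℂ) (f g : 𝓢(V, ℂ)) :
    F (schwartzConv f g) = ∫ z, f z * F (SchwartzMap.compSubConstCLM ℂ z g) := by
  rw [apply_eq_integral_of_weightedJet_eq_integral (integrable_weightedJet_smul_translate f g)
    (weightedJet_schwartzConv f g) F]
  simp only [map_smul, smul_eq_mul]

/-- Multiplication of a Schwartz function by the character `x ↦ e ^ (2πi ⟨z, x⟩)`. -/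
noncomputable def modulate (z : V) (f : 𝓢(V, ℂ)) : 𝓢(V, ℂ) :=
  𝓕⁻ (SchwartzMap.compSubConstCLM ℂ z (𝓕 f))

theorem modulate_apply (z : V) (f : 𝓢(V, ℂ)) (x : V) :
    modulate z f x = Real.fourierChar (inner ℝ z x) • f x := by
  rw [modulate, SchwartzMap.fourierInv_coe, Real.fourierInv_eq]
  simp only [SchwartzMap.compSubConstCLM_apply]
  rw [← integral_add_right_eq_self _ z]
  simp only [add_sub_cancel_right, inner_add_left, AddChar.map_add_eq_mul, mul_comm,
    mul_smul]
  simp only [Circle.smul_def]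
  rw [integral_smul]
  have h : f x = 𝓕⁻ (𝓕 f) x := by simp
  conv_rhs => rw [h, SchwartzMap.fourierInv_coe, Real.fourierInv_eq]
  simp only [Circle.smul_def]

theorem apply_schwartzMul (F : 𝓢(V, ℂ) →L[ℂ] ℂ) (g φ : 𝓢(V, ℂ)) :
    F (schwartzMul g φ) = ∫ z, (𝓕 g) z * F (modulate z φ) := by
  have h := apply_schwartzConv (F ∘L FourierTransform.fourierInvCLM ℂ 𝓢(V, ℂ)) (𝓕 g) (𝓕 φ)
  have hconv : 𝓕⁻ (schwartzConv (𝓕 g) (𝓕 φ)) = schwartzMul g φ := by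
    ext x
    have hneg : ∀ u : 𝓢(V, ℂ), (𝓕⁻ u) x = (𝓕 u) (-x) := fun u => by
      rw [SchwartzMap.fourierInv_apply_eq]; simp
    rw [hneg, fourier_schwartzConv, schwartzMul_apply, schwartzMul_apply, ← hneg, ← hneg]
    simp
  simpa [hconv, modulate] using h

end Convolution

section Distributions

variable {n : ℕ}

theorem MomentCondition.iteratedFDeriv_eq_zero {R : ℕ} {ψ : 𝓢(Rn n, ℂ)}
    (h : MomentCondition R ψ) : ∀ m < R, iteratedFDeriv ℝ m ψ 0 = 0 := by
  intro m hm
  refine ContinuousMultilinearMap.toMultilinearMap_injective ?_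
  refine Module.Basis.ext_multilinear
    (fun _ => (EuclideanSpace.basisFun (Fin n) ℝ).toBasis) fun v => ?_
  have := h m hm v
  rw [SchwartzMap.iteratedLineDerivOp_eq_iteratedFDeriv] at this
  simpa using this

/-- The dilation `h ↦ dilate t ht h` as a continuous linear map. -/
noncomputable def dilateCLM (t : ℝ) (ht : t ≠ 0) : 𝓢(Rn n, ℂ) →L[ℂ] 𝓢(Rn n, ℂ) :=
  SchwartzMap.compCLMOfContinuousLinearEquiv ℂ
    (ContinuousLinearEquiv.smulLeft (R₁ := ℝ) (M₁ := Rn n) (Units.mk0 t ht))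

/-- The functional `h ↦ (ĥ * f)(y)` on the Schwartz space. -/
noncomputable def convCLM (f : 𝓢'(Rn n, ℂ)) (y : Rn n) : 𝓢(Rn n, ℂ) →L[ℂ] ℂ :=
  (f : 𝓢(Rn n, ℂ) →L[ℂ] ℂ) ∘L SchwartzMap.compSubConstCLM ℂ y ∘L dilateCLM (-1) (by norm_num) ∘L
    ((((2 * Real.pi) ^ (-(n : ℝ) / 2) : ℝ) : ℂ) • dilateCLM ((2 * Real.pi)⁻¹) (by positivity)) ∘L
    FourierTransform.fourierCLM ℂ 𝓢(Rn n, ℂ)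

theorem convCLM_apply (f : 𝓢'(Rn n, ℂ)) (y : Rn n) (h : 𝓢(Rn n, ℂ)) :
    convCLM f y h = conv (fourierHat h) f y := rfl

theorem fourierHat_dilate_modulate {s : ℝ} (hs : s ≠ 0) (z x : Rn n) (φ : 𝓢(Rn n, ℂ)) :
    fourierHat (dilate s hs (modulate z φ)) x =
      fourierHat (dilate s hs φ) (x - (2 * Real.pi * s) • z) := by
  rw [fourierHat_apply, fourierHat_apply]
  congr 2
  funext ξ
  rw [dilate_apply, dilate_apply, modulate_apply, Circle.smul_def, Real.fourierChar_apply,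
    smul_eq_mul, ← mul_assoc, ← Complex.exp_add, inner_sub_left, inner_smul_left, inner_smul_right]
  congr 2
  simp only [conj_trivial]
  push_cast
  ring

theorem convCLM_dilate_modulate (f : 𝓢'(Rn n, ℂ)) (y z : Rn n) {s : ℝ} (hs : s ≠ 0)
    (φ : 𝓢(Rn n, ℂ)) :
    convCLM f y (dilate s hs (modulate z φ)) =
      convCLM f (y - (2 * Real.pi * s) • z) (dilate s hs φ) := by
  rw [convCLM_apply, convCLM_apply, conv, conv]
  congr 1
  ext x
  rw [conv_test_apply, conv_test_apply, fourierHat_dilate_modulate]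
  congr 1
  abel

theorem convCLM_dilate_schwartzMul (f : 𝓢'(Rn n, ℂ)) (y : Rn n) {s : ℝ} (hs : s ≠ 0)
    (g φ : 𝓢(Rn n, ℂ)) :
    convCLM f y (dilate s hs (schwartzMul g φ)) =
      ∫ z, (𝓕 g) z * convCLM f (y - (2 * Real.pi * s) • z) (dilate s hs φ) := by
  simp_rw [← convCLM_dilate_modulate]
  exact apply_schwartzMul (convCLM f y ∘L dilateCLM s hs) g φ

theorem one_add_norm_sub_rpow_le {E : Type*} [SeminormedAddCommGroup E] {a : ℝ} (ha : 0 ≤ a)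
    (u v : E) : 1 + ‖u - v‖ ^ a ≤ 2 * (1 + ‖u‖ ^ a) * (1 + ‖v‖) ^ a := by
  have hv : 1 ≤ (1 + ‖v‖) ^ a := Real.one_le_rpow (by linarith [norm_nonneg v]) ha
  have hu : 0 ≤ ‖u‖ ^ a := by positivity
  have hmax : ‖u - v‖ ≤ max 1 ‖u‖ * (1 + ‖v‖) := by
    calc ‖u - v‖ ≤ ‖u‖ + ‖v‖ := norm_sub_le u v
      _ ≤ max 1 ‖u‖ + max 1 ‖u‖ * ‖v‖ :=
          add_le_add (le_max_right _ _) (le_mul_of_one_le_left (norm_nonneg v) (le_max_left _ _))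
      _ = max 1 ‖u‖ * (1 + ‖v‖) := by ring
  have hmax_rpow : max 1 ‖u‖ ^ a ≤ 1 + ‖u‖ ^ a := by
    rcases le_total ‖u‖ 1 with h | h
    · rw [max_eq_left h, Real.one_rpow]; linarith
    · rw [max_eq_right h]; linarith
  have hsub : ‖u - v‖ ^ a ≤ (1 + ‖u‖ ^ a) * (1 + ‖v‖) ^ a := by
    calc ‖u - v‖ ^ a ≤ (max 1 ‖u‖ * (1 + ‖v‖)) ^ a := by gcongr
      _ = max 1 ‖u‖ ^ a * (1 + ‖v‖) ^ a := Real.mul_rpow (by positivity) (by positivity)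
      _ ≤ (1 + ‖u‖ ^ a) * (1 + ‖v‖) ^ a := by gcongr
  nlinarith

theorem one_add_norm_sub_smul_rpow_le {E : Type*} [SeminormedAddCommGroup E] [NormedSpace ℝ E]
    {a : ℝ} (ha : 0 ≤ a) {c : ℝ} (hc : 0 ≤ c) (u v : E) :
    1 + ‖u - c • v‖ ^ a ≤ 2 * (1 + c) ^ a * (1 + ‖u‖ ^ a) * (1 + ‖v‖) ^ a := by
  calc 1 + ‖u - c • v‖ ^ a
      ≤ 2 * (1 + ‖u‖ ^ a) * (1 + ‖c • v‖) ^ a := one_add_norm_sub_rpow_le ha _ _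
    _ ≤ 2 * (1 + ‖u‖ ^ a) * ((1 + c) * (1 + ‖v‖)) ^ a := by
        rw [norm_smul, Real.norm_of_nonneg hc]
        gcongr
        nlinarith [norm_nonneg v]
    _ = 2 * (1 + c) ^ a * (1 + ‖u‖ ^ a) * (1 + ‖v‖) ^ a := by
        rw [Real.mul_rpow (by positivity) (by positivity)]; ring

/-- The norm of `𝓕 g` in `L₁` with the weight `(1 + |z|) ^ a`; it bounds the Fourier multiplier
with symbol `g` on spaces of functions of growth `|y| ^ a`. -/
noncomputable def fourierWeight (a : ℝ) (g : 𝓢(Rn n, ℂ)) : ℝ≥0∞ :=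
  ∫⁻ z, ‖(𝓕 g) z‖ₑ * ENNReal.ofReal ((1 + ‖z‖) ^ a)

theorem enorm_convCLM_dilate_schwartzMul_le (f : 𝓢'(Rn n, ℂ)) (x y : Rn n) {s σ a : ℝ}
    (hs : 0 < s) (hσ : 0 ≤ σ) (ha : 0 ≤ a) (g φ : 𝓢(Rn n, ℂ)) {P : ℝ≥0∞}
    (hP : ∀ y', ‖convCLM f y' (dilate s hs.ne' φ)‖ₑ ≤
      P * ENNReal.ofReal (1 + ‖σ • (y' - x)‖ ^ a)) :
    ‖convCLM f y (dilate s hs.ne' (schwartzMul g φ))‖ₑ ≤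
      ENNReal.ofReal (2 * (1 + 2 * Real.pi * (σ * s)) ^ a) * fourierWeight a g * P *
        ENNReal.ofReal (1 + ‖σ • (y - x)‖ ^ a) := by
  set K : ℝ := 2 * (1 + 2 * Real.pi * (σ * s)) ^ a
  set T := 1 + ‖σ • (y - x)‖ ^ a
  have hshift (z : Rn n) : σ • (y - (2 * Real.pi * s) • z - x) =
      σ • (y - x) - (2 * Real.pi * (σ * s)) • z := by
    rw [sub_right_comm, smul_sub, smul_smul, mul_left_comm]
  have hpeetre (z : Rn n) :
      1 + ‖σ • (y - (2 * Real.pi * s) • z - x)‖ ^ a ≤ K * T * (1 + ‖z‖) ^ a := by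
    rw [hshift]
    exact one_add_norm_sub_smul_rpow_le ha (by positivity) _ z
  have hintegrand (z : Rn n) :
      ‖(𝓕 g) z * convCLM f (y - (2 * Real.pi * s) • z) (dilate s hs.ne' φ)‖ₑ ≤
        ‖(𝓕 g) z‖ₑ * ENNReal.ofReal ((1 + ‖z‖) ^ a) * (P * ENNReal.ofReal (K * T)) := by
    grw [enorm_mul, hP, hpeetre, ENNReal.ofReal_mul (by positivity)]
    exact le_of_eq (by ring)
  have hmeas : Measurable fun z : Rn n => ‖(𝓕 g) z‖ₑ * ENNReal.ofReal ((1 + ‖z‖) ^ a) := by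
    have := (𝓕 g).continuous
    fun_prop
  calc ‖convCLM f y (dilate s hs.ne' (schwartzMul g φ))‖ₑ
      ≤ ∫⁻ z, ‖(𝓕 g) z * convCLM f (y - (2 * Real.pi * s) • z) (dilate s hs.ne' φ)‖ₑ := by
        rw [convCLM_dilate_schwartzMul]
        exact enorm_integral_le_lintegral_enorm _
    _ ≤ fourierWeight a g * (P * ENNReal.ofReal (K * T)) := by
        grw [lintegral_mono hintegrand, lintegral_mul_const _ hmeas, fourierWeight]
    _ = ENNReal.ofReal K * fourierWeight a g * P * ENNReal.ofReal T := by
        rw [ENNReal.ofReal_mul (by positivity)]; ring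

theorem SchwartzBoundedBy.exists_fourierWeight_le {ι : Type*} {g : ι → 𝓢(Rn n, ℂ)} {θ : ι → ℝ}
    (hg : SchwartzBoundedBy g θ) (hθ : 0 ≤ θ) (a : ℝ) :
    ∃ C : ℝ, 0 ≤ C ∧ ∀ t, fourierWeight a (g t) ≤ ENNReal.ofReal (C * θ t) := by
  obtain ⟨q, hq, hqa⟩ := exists_lintegral_mul_one_add_norm_rpow_le (volume : Measure (Rn n)) a
  obtain ⟨C, hC, hCg⟩ := hg.exists_seminorm_le hθ
    (q := q.comp (FourierTransform.fourierCLM ℂ 𝓢(Rn n, ℂ) : 𝓢(Rn n, ℂ) →ₗ[ℂ] 𝓢(Rn n, ℂ)))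
    (hq.comp (FourierTransform.fourierCLM ℂ 𝓢(Rn n, ℂ)).continuous)
  exact ⟨C, hC, fun t => (hqa _).trans (ENNReal.ofReal_le_ofReal (hCg t))⟩

theorem exists_fourierWeight_dilate_mul_le_of_le_one (a : ℝ) {ψ : 𝓢(Rn n, ℂ)} {R : ℕ}
    (hψ : MomentCondition R ψ) (η : 𝓢(Rn n, ℂ)) :
    ∃ C : ℝ, 0 ≤ C ∧ ∀ (t : ℝ) (ht : t ≠ 0), t ∈ Set.Ioc 0 1 →
      fourierWeight a (schwartzMul (dilate t ht ψ) η) ≤ ENNReal.ofReal (C * t ^ R) := by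
  have hbound : SchwartzBoundedBy
      (fun t : Set.Ioc (0 : ℝ) 1 => schwartzMul (dilate t t.2.1.ne' ψ) η) fun t => (t : ℝ) ^ R :=
    schwartzBoundedBy_comp_smul_mul_of_le_one (ψ.smooth ⊤)
      (fun i => ⟨_, ψ.norm_iteratedFDeriv_le_seminorm ℝ i⟩) hψ.iteratedFDeriv_eq_zero
      (fun t => t.2) fun t x => schwartzMul_apply _ _ x
  obtain ⟨C, hC, h⟩ := hbound.exists_fourierWeight_le (fun t => pow_nonneg t.2.1.le R) a
  exact ⟨C, hC, fun t _ ht => h ⟨t, ht⟩⟩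

theorem exists_fourierWeight_dilate_mul_le_of_one_le (a : ℝ) (N : ℕ) (ψ : 𝓢(Rn n, ℂ))
    {η : 𝓢(Rn n, ℂ)} {ρ : ℝ} (hρ : 0 < ρ) (hη : ∀ x ∈ tsupport η, ρ ≤ ‖x‖) :
    ∃ C : ℝ, 0 ≤ C ∧ ∀ (t : ℝ) (ht : t ≠ 0), 1 ≤ t →
      fourierWeight a (schwartzMul (dilate t ht ψ) η) ≤ ENNReal.ofReal (C * (t ^ N)⁻¹) := by
  have hpos (t : Set.Ici (1 : ℝ)) : (0 : ℝ) < t := one_pos.trans_le t.2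
  have hbound : SchwartzBoundedBy
      (fun t : Set.Ici (1 : ℝ) => schwartzMul (dilate t (hpos t).ne' ψ) η)
      fun t => ((t : ℝ) ^ N)⁻¹ :=
    schwartzBoundedBy_comp_smul_mul_of_one_le ψ N (fun t => t.2) hρ hη
      fun t x => schwartzMul_apply _ _ x
  obtain ⟨C, hC, h⟩ :=
    hbound.exists_fourierWeight_le (fun t => inv_nonneg.2 (pow_nonneg (hpos t).le N)) a
  exact ⟨C, hC, fun t _ ht => h ⟨t, ht⟩⟩

end Distributions

section CalderonResolution

theorem exists_schwartz_div {E : Type*} [NormedAddCommGroup E] [NormedSpace ℝ E] {K : Set E}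
    (hK : IsCompact K) {χ φ : 𝓢(E, ℂ)} (hχ : ∀ x ∉ K, χ x = 0) (hφ : ∀ x ∈ K, φ x ≠ 0) :
    ∃ η : 𝓢(E, ℂ), tsupport η ⊆ K ∧ ∀ x, η x * φ x = χ x := by
  have hsupp : tsupport (fun x => χ x / φ x) ⊆ K := by
    refine closure_minimal (fun x hx => ?_) hK.isClosed
    by_contra hxK
    exact hx (by simp only [hχ x hxK, zero_div])
  have hsmooth : ContDiff ℝ ∞ fun x => χ x / φ x := by
    refine contDiff_iff_contDiffAt.2 fun x => ?_
    by_cases hx : x ∈ K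
    · simp_rw [div_eq_mul_inv]
      exact (χ.smooth ⊤).contDiffAt.mul ((φ.smooth ⊤).contDiffAt.inv (hφ x hx))
    · refine contDiffAt_const (c := (0 : ℂ)) |>.congr_of_eventuallyEq ?_
      filter_upwards [hK.isClosed.isOpen_compl.mem_nhds hx] with y hy
      rw [hχ y hy, zero_div]
  have hcpt : HasCompactSupport fun x => χ x / φ x :=
    hK.of_isClosed_subset (isClosed_tsupport _) hsupp
  refine ⟨hcpt.toSchwartzMap hsmooth, hsupp, fun x => ?_⟩
  change χ x / φ x * φ x = χ x
  by_cases hx : x ∈ K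
  · exact div_mul_cancel₀ _ (hφ x hx)
  · rw [hχ x hx, zero_div, zero_mul]

theorem exists_schwartz_cutoff (E : Type*) [NormedAddCommGroup E] [NormedSpace ℝ E]
    [FiniteDimensional ℝ E] {r s : ℝ} (hr : 0 < r) (hrs : r < s) :
    ∃ χ : 𝓢(E, ℂ), (∀ x, ‖x‖ ≤ r → χ x = 1) ∧ ∀ x, s ≤ ‖x‖ → χ x = 0 := by
  let b : ContDiffBump (0 : E) := ⟨r, s, hr, hrs⟩
  have hsmooth : ContDiff ℝ ∞ fun x => (b x : ℂ) := Complex.ofRealCLM.contDiff.comp b.contDiff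
  have hcpt : HasCompactSupport fun x => (b x : ℂ) :=
    b.hasCompactSupport.comp_left (g := Complex.ofReal) Complex.ofReal_zero
  refine ⟨hcpt.toSchwartzMap hsmooth, fun x hx => ?_, fun x hx => ?_⟩
  · exact Complex.ofReal_eq_one.2 (b.one_of_mem_closedBall (mem_closedBall_zero_iff.2 hx))
  · exact Complex.ofReal_eq_zero.2 (b.zero_of_le_dist (by rwa [dist_zero_right]))

variable {n : ℕ}

/-- Multipliers `η₀, η₁` for which the dyadic systems generated by `η₀, η₁` and `φ₀, φ₁` satisfy
`∑ j ≤ N, η_j φ_j = χ (2 ^ (-N) ·)`, which tends to `1`: a discrete Calderón reproducing formula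
on the Fourier side. -/
structure IsCalderonResolution (φ₀ φ₁ χ η₀ η₁ : 𝓢(Rn n, ℂ)) : Prop where
  apply_zero : χ 0 = 1
  mul_zero : ∀ x, η₀ x * φ₀ x = χ x
  mul_one : ∀ x, η₁ x * φ₁ x = χ ((2 : ℝ)⁻¹ • x) - χ x

theorem TauberianCondition.exists_isCalderonResolution {ε k : ℝ} (hε : 0 < ε) (hk : 1 < k)
    {φ₀ φ₁ : 𝓢(Rn n, ℂ)} (h : TauberianCondition ε k φ₀ φ₁) :
    ∃ χ η₀ η₁ : 𝓢(Rn n, ℂ), IsCalderonResolution φ₀ φ₁ χ η₀ η₁ ∧ ∀ x ∈ tsupport η₁, ε ≤ ‖x‖ := by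
  obtain ⟨χ, hχ_one, hχ_zero⟩ := exists_schwartz_cutoff (Rn n) hε (lt_mul_of_one_lt_left hε hk)
  set γ := dilate (2 : ℝ)⁻¹ (by norm_num) χ - χ
  have hγ (x : Rn n) : γ x = χ ((2 : ℝ)⁻¹ • x) - χ x := rfl
  have hnorm (x : Rn n) : ‖(2 : ℝ)⁻¹ • x‖ = ‖x‖ / 2 := by
    rw [norm_smul, norm_inv, Real.norm_ofNat, inv_mul_eq_div]
  set B : Set (Rn n) := Metric.closedBall 0 (k * ε)
  set S : Set (Rn n) := {x | ε ≤ ‖x‖} ∩ Metric.closedBall 0 (2 * k * ε)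
  have hχB : ∀ x ∉ B, χ x = 0 := fun x hx =>
    hχ_zero x (not_le.1 fun hx' => hx (mem_closedBall_zero_iff.2 hx')).le
  have hγS : ∀ x ∉ S, γ x = 0 := fun x hx => by
    rw [hγ]
    rcases not_and_or.1 hx with hx | hx
    · have hx : ‖x‖ < ε := not_le.1 hx
      rw [hχ_one x hx.le, hχ_one _ (by rw [hnorm]; linarith [norm_nonneg x]), sub_self]
    · rw [mem_closedBall_zero_iff, not_le] at hx
      rw [hχ_zero x (by nlinarith), hχ_zero _ (by rw [hnorm]; linarith), sub_self]
  obtain ⟨η₀, -, hη₀⟩ := exists_schwartz_div (isCompact_closedBall 0 _) hχB fun x hx =>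
    norm_pos_iff.1 (h.1 x (mem_closedBall_zero_iff.1 hx))
  obtain ⟨η₁, hη₁S, hη₁⟩ := exists_schwartz_div
    ((isCompact_closedBall 0 _).inter_left (isClosed_le continuous_const continuous_norm)) hγS
    fun x hx => norm_pos_iff.1 (h.2 x hx.1 (mem_closedBall_zero_iff.1 hx.2))
  exact ⟨χ, η₀, η₁, ⟨hχ_one 0 (by rw [norm_zero]; exact hε.le), hη₀, hη₁⟩,
    fun x hx => (hη₁S hx).1⟩

end CalderonResolution

section Dyadic

variable {n : ℕ}

/-- The dilation parameter of the `j`-th member of a dyadic system, in the normalization for which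
`2 ^ j * dyadicScale j` does not depend on `j`. -/
noncomputable def dyadicScale (j : ℕ) : ℝ := 2 * (2 ^ j)⁻¹

theorem dyadicScale_pos (j : ℕ) : 0 < dyadicScale j := by
  unfold dyadicScale; positivity

theorem dyadicScale_div_ne_zero (ν j : ℕ) : dyadicScale ν / dyadicScale j ≠ 0 :=
  (div_pos (dyadicScale_pos ν) (dyadicScale_pos j)).ne'

theorem dyadicScale_div_eq_inv_two_pow {ν j : ℕ} (h : j ≤ ν) :
    dyadicScale ν / dyadicScale j = (2 ^ (ν - j))⁻¹ := by
  rw [dyadicScale, dyadicScale, pow_sub₀ _ two_ne_zero h]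
  field_simp

theorem dyadicScale_div_eq_two_pow {ν j : ℕ} (h : ν ≤ j) :
    dyadicScale ν / dyadicScale j = 2 ^ (j - ν) := by
  rw [dyadicScale, dyadicScale, pow_sub₀ _ two_ne_zero h]
  field_simp

/-- The Schwartz function whose dilation by `dyadicScale j` is the `j`-th member of a dyadic
system; for `j = 0` the normalization of the scale forces the factor `2⁻¹`. -/
noncomputable def dyadicGenerator (ψ₀ ψ₁ : 𝓢(Rn n, ℂ)) : ℕ → 𝓢(Rn n, ℂ)
  | 0 => dilate 2⁻¹ (by norm_num) ψ₀
  | _ + 1 => ψ₁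

theorem dyadicSystem_eq_dilate (ψ₀ ψ₁ : 𝓢(Rn n, ℂ)) (j : ℕ) :
    dyadicSystem ψ₀ ψ₁ j =
      dilate (dyadicScale j) (dyadicScale_pos j).ne' (dyadicGenerator ψ₀ ψ₁ j) := by
  ext x
  cases j with
  | zero =>
    rw [dilate_apply, dyadicGenerator, dilate_apply, smul_smul, dyadicScale, pow_zero, inv_one,
      mul_one, inv_mul_cancel₀ two_ne_zero, one_smul, dyadicSystem]
  | succ j =>
    have hscale : dyadicScale (j + 1) = (2 ^ j)⁻¹ := by
      rw [dyadicScale, pow_succ', mul_inv, mul_inv_cancel_left₀ two_ne_zero]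
    rw [dyadicSystem, dilate_apply, dilate_apply, hscale, dyadicGenerator]

theorem IsCalderonResolution.sum_mul_dyadicSystem {χ φ₀ φ₁ η₀ η₁ : 𝓢(Rn n, ℂ)}
    (h : IsCalderonResolution φ₀ φ₁ χ η₀ η₁) (N : ℕ) (x : Rn n) :
    ∑ j ∈ Finset.range (N + 1), dyadicSystem η₀ η₁ j x * dyadicSystem φ₀ φ₁ j x =
      χ (((2 : ℝ) ^ N)⁻¹ • x) := by
  induction N with
  | zero => simp [dyadicSystem, h.mul_zero]
  | succ N ih =>
    rw [Finset.sum_range_succ, ih, dyadicSystem, dyadicSystem, dilate_apply, dilate_apply,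
      h.mul_one, smul_smul, pow_succ', mul_inv]
    ring

/-- The symbol `ψ_ν η_j` of the operator that takes `Φ_j * f` to the `j`-th term of `Ψ_ν * f`,
rescaled to the unit frequency of `η_j`. -/
noncomputable def linkSymbol (ψ₀ ψ₁ η₀ η₁ : 𝓢(Rn n, ℂ)) (ν j : ℕ) : 𝓢(Rn n, ℂ) :=
  schwartzMul (dilate (dyadicScale ν / dyadicScale j) (dyadicScale_div_ne_zero ν j)
    (dyadicGenerator ψ₀ ψ₁ ν)) (dyadicGenerator η₀ η₁ j)

theorem dilate_linkSymbol_apply (ψ₀ ψ₁ η₀ η₁ φ₀ φ₁ : 𝓢(Rn n, ℂ)) (ν j : ℕ) (x : Rn n) :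
    dilate (dyadicScale j) (dyadicScale_pos j).ne'
        (schwartzMul (linkSymbol ψ₀ ψ₁ η₀ η₁ ν j) (dyadicGenerator φ₀ φ₁ j)) x =
      dyadicSystem η₀ η₁ j x * dyadicSystem φ₀ φ₁ j x * dyadicSystem ψ₀ ψ₁ ν x := by
  simp only [dyadicSystem_eq_dilate, linkSymbol, dilate_apply, schwartzMul_apply, smul_smul,
    div_mul_cancel₀ _ (dyadicScale_pos j).ne']
  ring

theorem IsCalderonResolution.enorm_conv_dyadicSystem_le_tsum {χ φ₀ φ₁ η₀ η₁ : 𝓢(Rn n, ℂ)}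
    (h : IsCalderonResolution φ₀ φ₁ χ η₀ η₁) (ψ₀ ψ₁ : 𝓢(Rn n, ℂ)) (f : 𝓢'(Rn n, ℂ)) (ν : ℕ)
    (y : Rn n) :
    ‖conv (fourierHat (dyadicSystem ψ₀ ψ₁ ν)) f y‖ₑ ≤
      ∑' j, ‖convCLM f y (dilate (dyadicScale j) (dyadicScale_pos j).ne'
        (schwartzMul (linkSymbol ψ₀ ψ₁ η₀ η₁ ν j) (dyadicGenerator φ₀ φ₁ j)))‖ₑ := by
  set d : ℕ → 𝓢(Rn n, ℂ) := fun j => dilate (dyadicScale j) (dyadicScale_pos j).ne'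
    (schwartzMul (linkSymbol ψ₀ ψ₁ η₀ η₁ ν j) (dyadicGenerator φ₀ φ₁ j))
  have hpartial (N : ℕ) (x : Rn n) : (∑ j ∈ Finset.range (N + 1), d j) x =
      χ (((2 : ℝ) ^ N)⁻¹ • x) * dyadicSystem ψ₀ ψ₁ ν x := by
    simp only [d, sum_apply, dilate_linkSymbol_apply, ← Finset.sum_mul,
      h.sum_mul_dyadicSystem]
  have hscale : Filter.Tendsto (fun N : ℕ => ((2 : ℝ) ^ N)⁻¹) Filter.atTop (nhds 0) :=
    (tendsto_pow_atTop_atTop_of_one_lt one_lt_two).inv_tendsto_atTop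
  have hlim : Filter.Tendsto (fun N => ∑ j ∈ Finset.range (N + 1), d j) Filter.atTop
      (nhds (dyadicSystem ψ₀ ψ₁ ν)) :=
    tendsto_of_eq_cutoff_mul h.apply_zero
      (fun N => ⟨by positivity, inv_le_one_of_one_le₀ (one_le_pow₀ one_le_two)⟩) hscale hpartial
  refine le_of_tendsto' (((convCLM f y).continuous.tendsto _).comp hlim).enorm fun N => ?_
  rw [Function.comp_apply, map_sum]
  exact (enorm_sum_le _ _).trans (ENNReal.sum_le_tsum _)

theorem peetre_le_iff {ψ : ℕ → 𝓢(Rn n, ℂ)} {a : ℝ} {f : 𝓢'(Rn n, ℂ)} {j : ℕ} {x : Rn n}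
    {P : ℝ≥0∞} :
    peetre ψ a f j x ≤ P ↔ ∀ y, ‖conv (fourierHat (ψ j)) f y‖ₑ ≤
      P * ENNReal.ofReal (1 + ‖(2 : ℝ) ^ j • (y - x)‖ ^ a) := by
  refine iSup_le_iff.trans (forall_congr' fun y => ?_)
  have hpos : 0 < 1 + ‖(2 : ℝ) ^ j • (y - x)‖ ^ a := by positivity
  rw [ENNReal.ofReal_div_of_pos hpos, ofReal_norm, ENNReal.div_le_iff_le_mul
    (.inl (ENNReal.ofReal_pos.2 hpos).ne') (.inl ENNReal.ofReal_ne_top)]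

end Dyadic

section OffDiagonal

/-- Geometric factors `b ^ (ν - j)` for `j ≤ ν` and `c ^ (j - ν)` for `ν ≤ j`. -/
noncomputable def offDiag (b c : ℝ) (ν j : ℕ) : ℝ :=
  if j ≤ ν then b ^ (ν - j) else c ^ (j - ν)

theorem offDiag_nonneg {b c : ℝ} (hb : 0 ≤ b) (hc : 0 ≤ c) (ν j : ℕ) : 0 ≤ offDiag b c ν j := by
  unfold offDiag; split_ifs <;> positivity

theorem offDiag_mul (b c b' c' : ℝ) (ν j : ℕ) :
    offDiag b c ν j * offDiag b' c' ν j = offDiag (b * b') (c * c') ν j := by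
  unfold offDiag; split_ifs <;> rw [mul_pow]

theorem offDiag_le {b c s : ℝ} (hb : 0 ≤ b) (hc : 0 ≤ c) (hbs : b ≤ s) (hcs : c ≤ s) (ν j : ℕ) :
    offDiag b c ν j ≤ s ^ Nat.dist ν j := by
  unfold offDiag
  split_ifs with h
  · rw [Nat.dist_eq_sub_of_le_right h]; gcongr
  · rw [Nat.dist_eq_sub_of_le (not_le.1 h).le]; gcongr

theorem le_offDiag_mul {w : ℕ → ℝ} {b c : ℝ} (hb : 0 ≤ b) (hc : 0 < c)
    (hupper : ∀ j, w (j + 1) ≤ b * w j) (hlower : ∀ j, c * w j ≤ w (j + 1)) (ν j : ℕ) :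
    w ν ≤ offDiag b c⁻¹ ν j * w j := by
  unfold offDiag
  split_ifs with h
  · induction ν, h using Nat.le_induction with
    | base => rw [Nat.sub_self, pow_zero, one_mul]
    | succ ν h ih =>
      calc w (ν + 1) ≤ b * w ν := hupper ν
        _ ≤ b * (b ^ (ν - j) * w j) := by gcongr
        _ = b ^ (ν + 1 - j) * w j := by rw [Nat.succ_sub h, pow_succ']; ring
  · have hle := (not_le.1 h).le
    clear h
    induction j, hle using Nat.le_induction with
    | base => rw [Nat.sub_self, pow_zero, one_mul]
    | succ j h ih =>
      have hstep : w j ≤ c⁻¹ * w (j + 1) := (le_inv_mul_iff₀ hc).2 (hlower j)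
      calc w ν ≤ c⁻¹ ^ (j - ν) * w j := ih
        _ ≤ c⁻¹ ^ (j - ν) * (c⁻¹ * w (j + 1)) := by gcongr
        _ = c⁻¹ ^ (j + 1 - ν) * w (j + 1) := by rw [Nat.succ_sub h, pow_succ]; ring

theorem one_add_norm_two_pow_smul_rpow_le {E : Type*} [SeminormedAddCommGroup E]
    [NormedSpace ℝ E] {a : ℝ} (ha : 0 ≤ a) (ν j : ℕ) (z : E) :
    1 + ‖(2 : ℝ) ^ j • z‖ ^ a ≤ offDiag 1 (2 ^ a) ν j * (1 + ‖(2 : ℝ) ^ ν • z‖ ^ a) := by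
  unfold offDiag
  split_ifs with h
  · rw [one_pow, one_mul, norm_smul, norm_smul, norm_pow, norm_pow, Real.norm_ofNat]
    gcongr
    exact one_le_two
  · have hnorm : ‖(2 : ℝ) ^ j • z‖ = 2 ^ (j - ν) * ‖(2 : ℝ) ^ ν • z‖ := by
      rw [norm_smul, norm_smul, ← mul_assoc, norm_pow, norm_pow, Real.norm_ofNat, ← pow_add,
        Nat.sub_add_cancel (not_le.1 h).le]
    have hfactor : 1 ≤ ((2 : ℝ) ^ a) ^ (j - ν) := one_le_pow₀ (Real.one_le_rpow one_le_two ha)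
    rw [hnorm, Real.mul_rpow (by positivity) (norm_nonneg _), ← Real.rpow_pow_comm two_pos.le,
      mul_add, mul_one]
    gcongr

end OffDiagonal

section LinkSymbol

variable {n : ℕ}

theorem exists_fourierWeight_linkSymbol_le_of_le (a : ℝ) (ψ₀ : 𝓢(Rn n, ℂ)) {ψ₁ : 𝓢(Rn n, ℂ)}
    {R : ℕ} (hψ : MomentCondition R ψ₁) (η₀ η₁ : 𝓢(Rn n, ℂ)) :
    ∃ C : ℝ, 0 ≤ C ∧ ∀ ν j, j ≤ ν → fourierWeight a (linkSymbol ψ₀ ψ₁ η₀ η₁ ν j) ≤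
      ENNReal.ofReal (C * ((2 ^ R)⁻¹) ^ (ν - j)) := by
  have hpow (m : ℕ) : ((2 ^ m)⁻¹ : ℝ) ^ R = ((2 ^ R)⁻¹) ^ m := by
    rw [inv_pow, inv_pow, pow_right_comm]
  have hmem (m : ℕ) : ((2 ^ m)⁻¹ : ℝ) ∈ Set.Ioc 0 1 :=
    ⟨by positivity, inv_le_one_of_one_le₀ (one_le_pow₀ one_le_two)⟩
  have hgen (η : 𝓢(Rn n, ℂ)) := exists_fourierWeight_dilate_mul_le_of_le_one a hψ η
  obtain ⟨C, hC, h⟩ := exists_fourierWeight_dilate_mul_le_of_le_one a (R := 0)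
    (ψ := dyadicGenerator ψ₀ ψ₁ 0) (fun m hm => absurd hm (Nat.not_lt_zero m))
    (dyadicGenerator η₀ η₁ 0)
  obtain ⟨C₀, hC₀, h₀⟩ := hgen (dyadicGenerator η₀ η₁ 0)
  obtain ⟨C₁, hC₁, h₁⟩ := hgen η₁
  refine ⟨C + C₀ + C₁, by positivity, fun ν j hj => ?_⟩
  have hscale := dyadicScale_div_eq_inv_two_pow hj
  have hunit : dyadicScale ν / dyadicScale j ∈ Set.Ioc 0 1 := hscale ▸ hmem _
  rw [← hpow, ← hscale]
  rcases ν with _ | ν <;> rcases j with _ | j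
  · refine (h _ (dyadicScale_div_ne_zero 0 0) hunit).trans (ENNReal.ofReal_le_ofReal ?_)
    rw [div_self (dyadicScale_pos 0).ne', one_pow, one_pow]
    linarith
  · omega
  · refine (h₀ _ (dyadicScale_div_ne_zero _ 0) hunit).trans (ENNReal.ofReal_le_ofReal ?_)
    have := hunit.1
    gcongr
    linarith
  · refine (h₁ _ (dyadicScale_div_ne_zero _ _) hunit).trans (ENNReal.ofReal_le_ofReal ?_)
    have := hunit.1
    gcongr
    linarith

theorem exists_fourierWeight_linkSymbol_le_of_lt (a : ℝ) (N : ℕ) (ψ₀ ψ₁ η₀ : 𝓢(Rn n, ℂ))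
    {η₁ : 𝓢(Rn n, ℂ)} {ρ : ℝ} (hρ : 0 < ρ) (hη : ∀ x ∈ tsupport η₁, ρ ≤ ‖x‖) :
    ∃ C : ℝ, 0 ≤ C ∧ ∀ ν j, ν < j → fourierWeight a (linkSymbol ψ₀ ψ₁ η₀ η₁ ν j) ≤
      ENNReal.ofReal (C * ((2 ^ N)⁻¹) ^ (j - ν)) := by
  have hgen (ψ : 𝓢(Rn n, ℂ)) := exists_fourierWeight_dilate_mul_le_of_one_le a N ψ hρ hη
  obtain ⟨C₀, hC₀, h₀⟩ := hgen (dyadicGenerator ψ₀ ψ₁ 0)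
  obtain ⟨C₁, hC₁, h₁⟩ := hgen ψ₁
  refine ⟨C₀ + C₁, by positivity, fun ν j hj => ?_⟩
  have hscale := dyadicScale_div_eq_two_pow hj.le
  have hunit : 1 ≤ dyadicScale ν / dyadicScale j := hscale ▸ one_le_pow₀ one_le_two
  rw [inv_pow, pow_right_comm, ← hscale]
  obtain ⟨j, rfl⟩ := Nat.exists_eq_succ_of_ne_zero (Nat.ne_zero_of_lt hj)
  rcases ν with _ | ν
  · refine (h₀ _ (dyadicScale_div_ne_zero 0 _) hunit).trans (ENNReal.ofReal_le_ofReal ?_)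
    gcongr
    linarith
  · refine (h₁ _ (dyadicScale_div_ne_zero _ _) hunit).trans (ENNReal.ofReal_le_ofReal ?_)
    gcongr
    linarith

theorem exists_fourierWeight_linkSymbol_le (a : ℝ) (N : ℕ) (ψ₀ : 𝓢(Rn n, ℂ)) {ψ₁ : 𝓢(Rn n, ℂ)}
    {R : ℕ} (hψ : MomentCondition R ψ₁) (η₀ : 𝓢(Rn n, ℂ)) {η₁ : 𝓢(Rn n, ℂ)} {ρ : ℝ} (hρ : 0 < ρ)
    (hη : ∀ x ∈ tsupport η₁, ρ ≤ ‖x‖) :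
    ∃ C : ℝ, 0 < C ∧ ∀ ν j, fourierWeight a (linkSymbol ψ₀ ψ₁ η₀ η₁ ν j) ≤
      ENNReal.ofReal (C * offDiag (2 ^ R)⁻¹ (2 ^ N)⁻¹ ν j) := by
  obtain ⟨C₁, hC₁, hle⟩ := exists_fourierWeight_linkSymbol_le_of_le a ψ₀ hψ η₀ η₁
  obtain ⟨C₂, hC₂, hlt⟩ := exists_fourierWeight_linkSymbol_le_of_lt a N ψ₀ ψ₁ η₀ hρ hη
  refine ⟨C₁ + C₂ + 1, by positivity, fun ν j => ?_⟩
  unfold offDiag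
  split_ifs with h
  · refine (hle ν j h).trans (ENNReal.ofReal_le_ofReal ?_)
    gcongr
    linarith
  · refine (hlt ν j (not_le.1 h)).trans (ENNReal.ofReal_le_ofReal ?_)
    gcongr
    linarith

theorem exists_peetre_le_tsum {a : ℝ} (ha : 0 ≤ a) (N : ℕ) {R : ℕ} (ψ₀ : 𝓢(Rn n, ℂ))
    {ψ₁ φ₀ φ₁ : 𝓢(Rn n, ℂ)} (hψ : MomentCondition R ψ₁) {ε k : ℝ} (hε : 0 < ε) (hk : 1 < k)
    (hφ : TauberianCondition ε k φ₀ φ₁) :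
    ∃ C : ℝ, 0 < C ∧ ∀ (f : 𝓢'(Rn n, ℂ)) (ν : ℕ) (x : Rn n),
      peetre (dyadicSystem ψ₀ ψ₁) a f ν x ≤
        ∑' j, ENNReal.ofReal (C * offDiag (2 ^ R)⁻¹ ((2 ^ N)⁻¹ * 2 ^ a) ν j) *
          peetre (dyadicSystem φ₀ φ₁) a f j x := by
  obtain ⟨χ, η₀, η₁, hres, hη⟩ := hφ.exists_isCalderonResolution hε hk
  obtain ⟨C, hC, hlink⟩ := exists_fourierWeight_linkSymbol_le a N ψ₀ hψ η₀ hε hη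
  set K : ℝ := 2 * (1 + 2 * Real.pi * 2) ^ a
  refine ⟨K * C, by positivity, fun f ν x => peetre_le_iff.2 fun y => ?_⟩
  grw [hres.enorm_conv_dyadicSystem_le_tsum ψ₀ ψ₁ f ν y, ← ENNReal.tsum_mul_right]
  refine ENNReal.tsum_le_tsum fun j => ?_
  set P := peetre (dyadicSystem φ₀ φ₁) a f j x
  have hscale : 2 ^ j * dyadicScale j = 2 := by
    rw [dyadicScale, mul_left_comm, mul_inv_cancel₀ (by positivity), mul_one]
  have hterm := enorm_convCLM_dilate_schwartzMul_le f x y (dyadicScale_pos j)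
    (σ := 2 ^ j) (by positivity) ha (linkSymbol ψ₀ ψ₁ η₀ η₁ ν j) (dyadicGenerator φ₀ φ₁ j)
    (P := P) fun y' => by
      rw [← dyadicSystem_eq_dilate, convCLM_apply]
      exact peetre_le_iff.1 le_rfl y'
  have hB := offDiag_nonneg (b := (2 ^ R)⁻¹) (c := (2 ^ N)⁻¹) (by positivity) (by positivity) ν j
  have hD := offDiag_nonneg (b := 1) (c := 2 ^ a) zero_le_one (by positivity) ν j
  rw [hscale] at hterm
  grw [hterm, hlink, one_add_norm_two_pow_smul_rpow_le ha ν j, ENNReal.ofReal_mul hD]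
  rw [← mul_one ((2 ^ R)⁻¹ : ℝ), ← offDiag_mul, mul_one, mul_assoc K,
    ENNReal.ofReal_mul (p := K) (by positivity), ← mul_assoc C,
    ENNReal.ofReal_mul (p := C * _) (by positivity)]
  exact le_of_eq (by ring)

theorem exists_weightedPeetre_le_tsum {α₁ α₂ : ℝ} {w : ℕ → Rn n → ℝ} (hw : ∀ j x, 0 ≤ w j x)
    (hlower : ∀ j x, 2 ^ α₁ * w j x ≤ w (j + 1) x) (hupper : ∀ j x, w (j + 1) x ≤ 2 ^ α₂ * w j x)
    {a : ℝ} (ha : 0 ≤ a) {R : ℕ} (ψ₀ : 𝓢(Rn n, ℂ)) {ψ₁ φ₀ φ₁ : 𝓢(Rn n, ℂ)}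
    (hψ : MomentCondition R ψ₁) {ε k : ℝ} (hε : 0 < ε) (hk : 1 < k)
    (hφ : TauberianCondition ε k φ₀ φ₁) :
    ∃ C : ℝ, 0 < C ∧ ∀ (f : 𝓢'(Rn n, ℂ)) (ν : ℕ) (x : Rn n),
      weightedPeetre (dyadicSystem ψ₀ ψ₁) a w f ν x ≤
        ENNReal.ofReal C * ∑' j, ENNReal.ofReal (2 ^ (α₂ - R)) ^ Nat.dist ν j *
          weightedPeetre (dyadicSystem φ₀ φ₁) a w f j x := by
  obtain ⟨N, hN⟩ := exists_nat_ge (a - α₁ + R - α₂)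
  obtain ⟨C, hC, hpeetre⟩ := exists_peetre_le_tsum ha N ψ₀ hψ hε hk hφ
  refine ⟨C, hC, fun f ν x => ?_⟩
  have hR : ((2 ^ R)⁻¹ * 2 ^ α₂ : ℝ) ≤ 2 ^ (α₂ - R) := by
    rw [Real.rpow_sub two_pos, Real.rpow_natCast, inv_mul_eq_div]
  have hN' : ((2 ^ N)⁻¹ * 2 ^ a * (2 ^ α₁)⁻¹ : ℝ) ≤ 2 ^ (α₂ - R) := by
    rw [← Real.rpow_natCast, ← Real.rpow_neg two_pos.le, ← Real.rpow_neg two_pos.le,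
      ← Real.rpow_add two_pos, ← Real.rpow_add two_pos]
    exact Real.rpow_le_rpow_of_exponent_le one_le_two (by linarith)
  set B : ℕ → ℝ := offDiag (2 ^ R)⁻¹ ((2 ^ N)⁻¹ * 2 ^ a) ν
  have hB (j : ℕ) : 0 ≤ B j := offDiag_nonneg (by positivity) (by positivity) ν j
  have hweight (j : ℕ) : B j * w ν x ≤ (2 ^ (α₂ - R)) ^ Nat.dist ν j * w j x := by
    calc B j * w ν x ≤ B j * (offDiag (2 ^ α₂) (2 ^ α₁)⁻¹ ν j * w j x) :=
          mul_le_mul_of_nonneg_left (le_offDiag_mul (by positivity)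
            (by positivity) (fun i => hupper i x) (fun i => hlower i x) ν j) (hB j)
      _ = offDiag ((2 ^ R)⁻¹ * 2 ^ α₂) ((2 ^ N)⁻¹ * 2 ^ a * (2 ^ α₁)⁻¹) ν j * w j x := by
          rw [← mul_assoc, offDiag_mul]
      _ ≤ (2 ^ (α₂ - R)) ^ Nat.dist ν j * w j x :=
          mul_le_mul_of_nonneg_right
            (offDiag_le (by positivity) (by positivity) hR hN' ν j) (hw j x)
  unfold weightedPeetre
  grw [hpeetre, ← ENNReal.tsum_mul_right, ← ENNReal.tsum_mul_left]
  refine ENNReal.tsum_le_tsum fun j => ?_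
  calc ENNReal.ofReal (C * B j) * peetre (dyadicSystem φ₀ φ₁) a f j x * ENNReal.ofReal (w ν x)
      = ENNReal.ofReal C * ENNReal.ofReal (B j * w ν x) * peetre (dyadicSystem φ₀ φ₁) a f j x := by
        rw [ENNReal.ofReal_mul hC.le, ENNReal.ofReal_mul (hB j)]; ring
    _ ≤ ENNReal.ofReal C * ENNReal.ofReal ((2 ^ (α₂ - R)) ^ Nat.dist ν j * w j x) *
          peetre (dyadicSystem φ₀ φ₁) a f j x := by grw [hweight j]
    _ = _ := by
        rw [ENNReal.ofReal_mul (by positivity), ENNReal.ofReal_pow (by positivity)]; ring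

end LinkSymbol

end VarMorrey

theorem theorem4p7_general {n : ℕ} {ρ : (VarMorrey.Rn n → ℝ≥0∞) → ℝ≥0∞} (hρ : VarMorrey.IsSolid ρ)
    {q : VarMorrey.Rn n → ℝ≥0∞} (hq : 0 < essInf q volume)
    {α₁ α₂ : ℝ} {w : ℕ → VarMorrey.Rn n → ℝ} (hw : ∀ j x, 0 ≤ w j x)
    (hlower : ∀ j x, 2 ^ α₁ * w j x ≤ w (j + 1) x) (hupper : ∀ j x, w (j + 1) x ≤ 2 ^ α₂ * w j x)
    {a : ℝ} (ha : 0 ≤ a) {R : ℕ} (hR : α₂ < R) (ψ₀ : 𝓢(VarMorrey.Rn n, ℂ))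
    {ψ₁ φ₀ φ₁ : 𝓢(VarMorrey.Rn n, ℂ)} (hψ : VarMorrey.MomentCondition R ψ₁)
    {ε k : ℝ} (hε : 0 < ε) (hk : 1 < k) (hφ : VarMorrey.TauberianCondition ε k φ₀ φ₁) :
    ∃ c : ℝ, 0 < c ∧ ∀ f : 𝓢'(VarMorrey.Rn n, ℂ),
      ρ (fun x => VarMorrey.ellNorm (q x) fun j =>
          VarMorrey.weightedPeetre (VarMorrey.dyadicSystem ψ₀ ψ₁) a w f j x) ≤
        ENNReal.ofReal c * ρ (fun x => VarMorrey.ellNorm (q x) fun j =>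
          VarMorrey.weightedPeetre (VarMorrey.dyadicSystem φ₀ φ₁) a w f j x) := by
  obtain ⟨C, hC, hpointwise⟩ :=
    VarMorrey.exists_weightedPeetre_le_tsum hw hlower hupper ha ψ₀ hψ hε hk hφ
  have hratio : ENNReal.ofReal (2 ^ ((α₂ - R) / 2)) < 1 := by
    rw [ENNReal.ofReal_lt_one]
    exact Real.rpow_lt_one_of_one_lt_of_neg one_lt_two (by linarith)
  have hsq : ENNReal.ofReal (2 ^ ((α₂ - R) / 2)) ^ 2 = ENNReal.ofReal (2 ^ (α₂ - R)) := by
    rw [sq, ← ENNReal.ofReal_mul (by positivity), ← Real.rpow_add two_pos, add_halves]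
  obtain ⟨c, hc, hnorm⟩ := hρ.exists_ellNorm_le_of_le_tsum hq hratio
    (ENNReal.ofReal_pos.2 hC).ne' ENNReal.ofReal_ne_top
  refine ⟨c, hc, fun f => hnorm _ _ fun ν x => ?_⟩
  rw [hsq]
  exact hpointwise f ν x

theorem theorem4p7 {n : ℕ} (hn : 0 < n)
    {α α₁ α₂ : ℝ} {w : ℕ → VarMorrey.Rn n → ℝ} (hw : VarMorrey.IsAdmissibleWeight α α₁ α₂ w)
    {p q u : VarMorrey.Rn n → ℝ≥0∞}
    (hp : VarMorrey.IsVarExponent p) (hq : VarMorrey.IsVarExponent q)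
    (hu : VarMorrey.IsVarExponent u) (hpu : ∀ x, p x ≤ u x)
    {a : ℝ} (ha : 0 < a) {R : ℕ} (hR : α₂ < (R : ℝ))
    (ψ₀ ψ₁ φ₀ φ₁ : 𝓢(VarMorrey.Rn n, ℂ))
    (hψ : VarMorrey.MomentCondition R ψ₁)
    {ε k : ℝ} (hε : 0 < ε) (hk : k ∈ Set.Ioc (1 : ℝ) 2)
    (hφ : VarMorrey.TauberianCondition ε k φ₀ φ₁) :
    ∃ c : ℝ, 0 < c ∧ ∀ f : 𝓢'(VarMorrey.Rn n, ℂ),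
      VarMorrey.morreyEllNorm p u q
          (VarMorrey.weightedPeetre (VarMorrey.dyadicSystem ψ₀ ψ₁) a w f) ≤
        ENNReal.ofReal c *
          VarMorrey.morreyEllNorm p u q
            (VarMorrey.weightedPeetre (VarMorrey.dyadicSystem φ₀ φ₁) a w f) :=
  theorem4p7_general (VarMorrey.isSolid_morreyNorm p u) hq.essInf_pos (fun j x => (hw.pos j x).le)
    hw.lower hw.upper ha.le hR ψ₀ hψ hε hk.1 hφ
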